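/- **Theorem (non-reversible Eisenbaum isomorphism).** Let $n\ge 1$, let $P$ be an irreducible transition probability matrix on $[n]=\{1,\dots,n\}$ with stationary distribution $p$, and let $Q=\mathrm{diag}(p)(P-I)$ be its Laplacian, i.e. the rate matrix of an irreducible continuous-time Markov chain on $[n]$; the reversed chain is the continuous-time Markov chain with rate matrix $Q^{T}$. Let $h>0$. For a function $F:\mathbb{C}^n\to\mathbb{C}$ for which the integral converges absolutely, write $$[F]_{\mu_{h\mathbf 1}}:=\int_{\mathbb{C}^n}F(\phi)\,\frac{1}{\pi^{n}\,|G_h|}\,e^{\langle\phi,(Q-hI)\bar\phi\rangle}\,dx\,dy,\qquad \phi=x+\mathrm{i}y,\quad G_h=(hI-Q)^{-1},\quad \langle\phi,\psi\rangle=\sum_i\phi_i\psi_i,$$ where $|G_h|$ is the determinant of $G_h$ (this is integration against the twisted Gaussian measure $\mu_{h\mathbf 1}$). Let $a\in[n]$ and $r>0$. Let $(X_t)_{t\ge0}$ be the reversed chain started at $X_0=a$, with right-continuous paths; write $\mathbb{E}_a^*$ for expectation, let $\mathcal{L}_t=(\mathcal{L}_t^i)_{i\in[n]}$ with $\mathcal{L}_t^i=\int_0^t\mathbf{1}\{X_s=i\}\,ds$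 be its local times, and let $\zeta$ be an exponential random variable with mean $h^{-1}$ independent of $X$. Let $u:\mathbb{R}_+^n\to\mathbb{C}$ have property $\mathfrak F$: $u$ is $C^\infty$ on the closed orthant $\mathbb{R}_+^n=[0,\infty)^n$ (up to the boundary), and for all integers $k,d\ge0$ the function $(1+\|l\|)^{d}\,\|D^{k}u(l)\|$ is bounded on $\mathbb{R}_+^n$. Then, with $|\phi+\sqrt r\,\mathbf 1|^2:=(|\phi_i+\sqrt r|^2)_{i\in[n]}$, all the integrals and expectations below converge absolutely, and $$\bigg[\Big(\frac{\phi_a+\sqrt r}{\sqrt r}\Big)\,u\big(|\phi+\sqrt r\,\mathbf 1|^2\big)\bigg]_{\mu_{h\mathbf 1}}=\Big[\mathbb{E}_a^*\big[u\big(|\phi+\sqrt r\,\mathbf 1|^2+\mathcal{L}_\zeta\big)\big]\Big]_{\mu_{h\mathbf 1}}.$$ -/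

import Mathlib

open MeasureTheory ProbabilityTheory
open scoped NNReal ComplexConjugate

namespace PermanentalIso

/-- `Q` is the (normalized) Laplacian of an irreducible Markov chain on `{0, …, n - 1}`:
`Q = Π (P - I)`, where `P` is an irreducible transition probability matrix, `p` is its stationary
distribution and `Π = diag(p)`. Off the diagonal, `Q i j` is the rate of jumping from `i` to `j`. -/
def IsIrreducibleLaplacian {n : ℕ} (Q : Matrix (Fin n) (Fin n) ℝ) : Prop :=
  ∃ (P : Matrix (Fin n) (Fin n) ℝ) (p : Fin n → ℝ),
    P ∈ Matrix.rowStochastic ℝ (Fin n) ∧ P.IsIrreducible ∧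
    p ∈ stdSimplex ℝ (Fin n) ∧ Matrix.vecMul p P = p ∧
    Q = Matrix.diagonal p * (P - 1)

/-- Under the probability measure `Pr`, the process `X` is a continuous-time Markov chain with rate
matrix `R` (`R i j` being the rate from `i` to `j`) started at `a`: it has right-continuous paths
(for the discrete topology on the state space), and its finite-dimensional distributions are
`Pr(X_{t₀} = x₀, …, X_{tₘ} = xₘ) = 1{x₀ = a} ∏ₖ (exp ((tₖ₊₁ - tₖ) R))(xₖ, xₖ₊₁)`
for all times `0 = t₀ ≤ t₁ ≤ … ≤ tₘ`. -/
structure IsMarkovChain {n : ℕ} {Ω : Type*} [MeasurableSpace Ω] (R : Matrix (Fin n) (Fin n) ℝ)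
    (a : Fin n) (X : ℝ≥0 → Ω → Fin n) (Pr : Measure Ω) : Prop where
  measurable : ∀ t, Measurable (X t)
  rightContinuous : ∀ ω t, ContinuousWithinAt (fun s => X s ω) (Set.Ici t) t
  finiteDimensional : ∀ (m : ℕ) (t : Fin (m + 1) → ℝ≥0) (x : Fin (m + 1) → Fin n),
    Monotone t → t 0 = 0 →
    Pr.real {ω | ∀ k, X (t k) ω = x k} =
      (if x 0 = a then 1 else 0) *
        ∏ k : Fin m,
          (NormedSpace.exp (((t k.succ : ℝ) - (t k.castSucc : ℝ)) • R)) (x k.castSucc) (x k.succ)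

/-- The local time `𝓛_t^i = ∫₀ᵗ 1{X_s = i} ds`, `t ≥ 0`, as a vector indexed by `i`. -/
noncomputable def localTime {n : ℕ} {Ω : Type*} (X : ℝ≥0 → Ω → Fin n) (t : ℝ) (ω : Ω) :
    Fin n → ℝ :=
  fun i => ∫ s in (0 : ℝ)..t, if X s.toNNReal ω = i then (1 : ℝ) else 0

/-- The closed orthant `ℝ₊ⁿ`. -/
def orthant (n : ℕ) : Set (Fin n → ℝ) := {l | ∀ i, 0 ≤ l i}

/-- Property `𝔉`: `u` is smooth on `ℝ₊ⁿ` (up to the boundary) and all its derivatives, of every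
order, decay faster than any power at infinity. Only the values of `u` on `ℝ₊ⁿ` matter. -/
structure PropertyF {n : ℕ} (u : (Fin n → ℝ) → ℂ) : Prop where
  smooth : ContDiffOn ℝ ((⊤ : ℕ∞) : WithTop ℕ∞) u (orthant n)
  decay : ∀ k d : ℕ, ∃ C : ℝ, ∀ l ∈ orthant n,
    (1 + ‖l‖) ^ d * ‖iteratedFDerivWithin ℝ k u (orthant n) l‖ ≤ C

/-- `Q_h = Q - diag(h)`, the Laplacian with killing rates `h = (h_1, …, h_n)`. -/
def killedLaplacian {n : ℕ} (Q : Matrix (Fin n) (Fin n) ℝ) (h : Fin n → ℝ) :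
    Matrix (Fin n) (Fin n) ℝ :=
  Q - Matrix.diagonal h

/-- The Green kernel `G_h = (-Q_h)⁻¹`. -/
noncomputable def greenKernel {n : ℕ} (Q : Matrix (Fin n) (Fin n) ℝ) (h : Fin n → ℝ) :
    Matrix (Fin n) (Fin n) ℝ :=
  (-killedLaplacian Q h)⁻¹

/-- The complex density, with respect to Lebesgue measure `du dv` on `ℂⁿ` (`φ = u + i v`), of the
twisted Gaussian measure
`dμ_h = ((2πi)ⁿ |G_h|)⁻¹ exp ⟨φ, Q_h φ̄⟩ dφ̄ dφ = (πⁿ |G_h|)⁻¹ exp ⟨φ, Q_h φ̄⟩ du dv`,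
where `⟨φ, ψ⟩ = ∑ᵢ φᵢ ψᵢ`, without conjugation. -/
noncomputable def twistedDensity {n : ℕ} (Q : Matrix (Fin n) (Fin n) ℝ) (h : Fin n → ℝ)
    (φ : Fin n → ℂ) : ℂ :=
  ((Real.pi ^ n * (greenKernel Q h).det : ℝ) : ℂ)⁻¹ *
    Complex.exp (∑ i, ∑ j, φ i * (killedLaplacian Q h i j : ℂ) * conj (φ j))

/-- `F` is (absolutely) integrable with respect to the twisted Gaussian measure `μ_h`. -/
def TwistedIntegrable {n : ℕ} (Q : Matrix (Fin n) (Fin n) ℝ) (h : Fin n → ℝ)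
    (F : (Fin n → ℂ) → ℂ) : Prop :=
  Integrable (fun φ => F φ * twistedDensity Q h φ)

/-- The bracket `[F]_{μ_h}`: integration of `F` against the twisted Gaussian measure `μ_h`. -/
noncomputable def twistedIntegral {n : ℕ} (Q : Matrix (Fin n) (Fin n) ℝ) (h : Fin n → ℝ)
    (F : (Fin n → ℂ) → ℂ) : ℂ :=
  ∫ φ, F φ * twistedDensity Q h φ

/-- The vector `|φ + √r 𝟏|² ∈ ℝ₊ⁿ`, with the operations taken coordinatewise. -/
noncomputable def shiftedSq {n : ℕ} (r : ℝ) (φ : Fin n → ℂ) : Fin n → ℝ :=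
  fun i => ‖φ i + (Real.sqrt r : ℂ)‖ ^ 2

end PermanentalIso

/-! The identity comes from one integration by parts combined with one resolvent equation. Write s =
|φ + √r 𝟏|², W_x = E[u(s + 𝓛_ζ) 1{X_ζ = x}] and D_x = E[∂_x u(s + 𝓛_ζ) 1{X_ζ = x}].

Gaussian side (`integral_wirtinger_eq_zero`): applying ∂/∂φ̄_x to u(s + l) exp⟨φ, Q_h φ̄⟩ produces
(∑ᵢ φᵢ (Q_h)ᵢₓ) u + (φ_x + √r) ∂_x u times the weight, and this integrates to zero for every fixed l
in the orthant. Taking l = 𝓛_ζ on the event X_ζ = x and using Fubini gives the same statement with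
W_x and D_x in place of u and ∂_x u (`integral_wirtinger_weightedState`).

Markov side (`sum_integral_weightedState`): along a path, 𝓛 grows at unit speed in the coordinate
X_t, so u(l + 𝓛_t) changes at rate ∂_{X_t} u. With the Markov property this is Duhamel's formula
(`expectState_eq`). Its Laplace transform in t turns the convolution into a product, and multiplying
by h - Qᵀ leaves ∑ₓ Wₓ (h - Qᵀ)ₓ_z = h u(s) 1{a = z} + D_z.

Summing the Gaussian identities over x and eliminating D_x (`sum_divergence_eq`), the terms in Q
cancel because the columns of Q sum to zero, which permits φ to be shifted to φ + √r 𝟏. What remains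
is h√r ∑ₓ Wₓ - h (φ_a + √r) u(s), whose integral is therefore zero. Since ∑ₓ Wₓ = E[u(s + 𝓛_ζ)],
this is the theorem. -/

namespace PermanentalIso

open Filter Topology Set

/-! ### Row sums, column sums and dissipativity of the Laplacian. -/

section Laplacian

variable {n : ℕ} {Q : Matrix (Fin n) (Fin n) ℝ}

theorem IsIrreducibleLaplacian.sum_row (hQ : IsIrreducibleLaplacian Q) (i : Fin n) :
    ∑ j, Q i j = 0 := by
  obtain ⟨P, p, hP, -, -, -, rfl⟩ := hQ
  have h1 : ∑ j, P i j = 1 := by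
    have := congrFun hP.2 i
    simpa [Matrix.mulVec, dotProduct] using this
  simp [Matrix.diagonal_mul, ← Finset.mul_sum, Finset.sum_sub_distrib, h1, Matrix.one_apply]

/-- This is stationarity of p; it makes the transpose a rate matrix as well. -/
theorem IsIrreducibleLaplacian.sum_col (hQ : IsIrreducibleLaplacian Q) (j : Fin n) :
    ∑ i, Q i j = 0 := by
  obtain ⟨P, p, hP, -, -, hp, rfl⟩ := hQ
  have h1 : ∑ i, p i * P i j = p j := by
    have := congrFun hp j
    simpa [Matrix.vecMul, dotProduct] using this
  simp [Matrix.diagonal_mul, mul_sub, Finset.sum_sub_distrib, h1, Matrix.one_apply]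

/-- The jump rate out of i is at most p i ≤ 1, so the chain can be uniformized at rate 1. -/
theorem IsIrreducibleLaplacian.add_one_nonneg (hQ : IsIrreducibleLaplacian Q) (i j : Fin n) :
    0 ≤ (Q + 1) i j := by
  obtain ⟨P, p, hP, -, hp, -, rfl⟩ := hQ
  have h1 := hP.1 i j
  have h2 : 0 ≤ p i := hp.1 i
  have h3 : p i ≤ 1 := by
    rw [← hp.2]
    exact Finset.single_le_sum (fun k _ => hp.1 k) (Finset.mem_univ i)
  have h4 := mul_nonneg h2 h1
  by_cases hij : i = j
  · subst hij
    simp [Matrix.diagonal_mul]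
    nlinarith
  · simp [Matrix.diagonal_mul, hij]
    exact h4

/-- The quadratic form of a Laplacian has nonpositive real part. -/
theorem IsIrreducibleLaplacian.re_sum_nonpos (hQ : IsIrreducibleLaplacian Q) (φ : Fin n → ℂ) :
    (∑ i, ∑ j, φ i * (Q i j : ℂ) * conj (φ j)).re ≤ 0 := by
  -- Off the diagonal this is ab ≤ (a² + b²)/2 with a nonnegative rate. On the diagonal it is an
  -- equality, so the sign of Q i i does not matter.
  have key : ∀ i j, (φ i * (Q i j : ℂ) * conj (φ j)).re ≤
      (Q i j) * (‖φ i‖ ^ 2 + ‖φ j‖ ^ 2) / 2 := by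
    intro i j
    have hre : (φ i * (Q i j : ℂ) * conj (φ j)).re =
        Q i j * ((φ i).re * (φ j).re + (φ i).im * (φ j).im) := by
      simp [Complex.mul_re, Complex.mul_im]; ring
    rw [hre, Complex.sq_norm, Complex.sq_norm, Complex.normSq_apply, Complex.normSq_apply]
    by_cases hij : i = j
    · subst hij; apply le_of_eq; ring
    · have h0 : 0 ≤ Q i j := by
        have := hQ.add_one_nonneg i j
        simpa [Matrix.one_apply, hij] using this
      have h1 : 0 ≤ ((φ i).re - (φ j).re) ^ 2 + ((φ i).im - (φ j).im) ^ 2 := by positivity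
      have := mul_nonneg h0 h1
      nlinarith
  calc (∑ i, ∑ j, φ i * (Q i j : ℂ) * conj (φ j)).re
      = ∑ i, ∑ j, (φ i * (Q i j : ℂ) * conj (φ j)).re := by simp only [Complex.re_sum]
    _ ≤ ∑ i, ∑ j, (Q i j) * (‖φ i‖ ^ 2 + ‖φ j‖ ^ 2) / 2 :=
        Finset.sum_le_sum fun i _ => Finset.sum_le_sum fun j _ => key i j
    _ = (∑ i, (∑ j, Q i j) * ‖φ i‖ ^ 2 + ∑ j, (∑ i, Q i j) * ‖φ j‖ ^ 2) / 2 := by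
        simp only [Finset.sum_mul]
        rw [Finset.sum_comm (f := fun j i => Q i j * ‖φ j‖ ^ 2)]
        simp only [← Finset.sum_add_distrib, Finset.sum_div]
        refine Finset.sum_congr rfl fun i _ => Finset.sum_congr rfl fun j _ => ?_
        ring
    _ = 0 := by simp [hQ.sum_row, hQ.sum_col]

end Laplacian

/-! ### The semigroup of a rate matrix and its Laplace transform. -/

section MatrixExp

variable {n : ℕ}

open scoped Matrix.Norms.Operator in
/-- The entries of the semigroup generated by a rate matrix are bounded by `1`. -/
theorem abs_exp_smul_apply_le_one {R : Matrix (Fin n) (Fin n) ℝ}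
    (hR : ∀ i j, 0 ≤ (R + 1) i j) (hsum : ∀ i, ∑ j, R i j = 0) {t : ℝ} (ht : 0 ≤ t)
    (i j : Fin n) : |NormedSpace.exp (t • R) i j| ≤ 1 := by
  have : Nonempty (Fin n) := ⟨i⟩
  -- Uniformization: R + 1 is stochastic, so it has norm at most 1 in the maximal row sum norm, and
  -- exp(tR) = e⁻ᵗ exp(t(R + 1)).
  have hnorm : ‖R + 1‖ ≤ 1 := by
    rw [Matrix.linfty_opNorm_def]
    have : ∀ i, ∑ j, ‖(R + 1) i j‖₊ ≤ 1 := by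
      intro i
      rw [← NNReal.coe_le_coe]
      push_cast
      have : ∀ j, ‖(R + 1) i j‖ = R i j + (1 : Matrix (Fin n) (Fin n) ℝ) i j := fun j => by
        rw [Real.norm_of_nonneg (hR i j)]; rfl
      rw [Finset.sum_congr rfl fun j _ => this j]
      simp [Finset.sum_add_distrib, hsum, Matrix.one_apply]
    exact_mod_cast Finset.sup_le fun i _ => this i
  have hbig : ‖NormedSpace.exp (t • (R + 1))‖ ≤ Real.exp t := by
    have h1 := NormedSpace.exp_series_hasSum_exp' (𝕂 := ℝ) (t • (R + 1))
    have h2 : HasSum (fun k : ℕ => ((k.factorial : ℝ)⁻¹) * t ^ k) (Real.exp t) := by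
      have := NormedSpace.exp_series_hasSum_exp' (𝕂 := ℝ) t
      simpa [Real.exp_eq_exp_ℝ] using this
    refine (congrArg norm h1.tsum_eq).symm.trans_le (tsum_of_norm_bounded h2 fun k => ?_)
    rw [norm_smul, norm_inv, RCLike.norm_natCast]
    gcongr
    calc ‖(t • (R + 1)) ^ k‖ ≤ ‖t • (R + 1)‖ ^ k := norm_pow_le _ _
      _ ≤ t ^ k := by
        gcongr
        rw [norm_smul, Real.norm_of_nonneg ht]
        exact mul_le_of_le_one_right ht hnorm
  have hsplit : NormedSpace.exp (t • R) =
      Real.exp (-t) • NormedSpace.exp (t • (R + 1)) := by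
    have : t • R = (-t) • (1 : Matrix (Fin n) (Fin n) ℝ) + t • (R + 1) := by
      rw [smul_add]; abel_nf; simp
    rw [this, Matrix.exp_add_of_commute]
    · have : NormedSpace.exp ((-t) • (1 : Matrix (Fin n) (Fin n) ℝ)) = Real.exp (-t) • 1 := by
        rw [← Matrix.diagonal_one, ← Matrix.diagonal_smul, Matrix.exp_diagonal, ← Matrix.diagonal_smul]
        congr 1
        ext i
        simp [Pi.coe_exp, Real.exp_eq_exp_ℝ]
      rw [this, smul_mul_assoc, one_mul]
    · exact (Commute.one_left _).smul_left _
  have hent : ∀ A : Matrix (Fin n) (Fin n) ℝ, |A i j| ≤ ‖A‖ := by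
    intro A
    rw [Matrix.linfty_opNorm_def]
    have h1 : ‖A i j‖₊ ≤ ∑ j, ‖A i j‖₊ :=
      Finset.single_le_sum (f := fun j => ‖A i j‖₊) (fun _ _ => zero_le) (Finset.mem_univ j)
    have h2 := h1.trans (Finset.le_sup (f := fun i => ∑ j, ‖A i j‖₊) (Finset.mem_univ i))
    exact_mod_cast h2
  rw [hsplit]
  calc |(Real.exp (-t) • NormedSpace.exp (t • (R + 1))) i j|
      ≤ ‖Real.exp (-t) • NormedSpace.exp (t • (R + 1))‖ := hent _
    _ ≤ Real.exp (-t) * Real.exp t := by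
        rw [norm_smul, Real.norm_of_nonneg (Real.exp_pos _).le]
        gcongr
    _ = 1 := by rw [← Real.exp_add]; simp

open scoped Matrix.Norms.Operator in
theorem hasDerivAt_exp_smul_apply (R : Matrix (Fin n) (Fin n) ℝ) (t : ℝ) (i j : Fin n) :
    HasDerivAt (fun s : ℝ => NormedSpace.exp (s • R) i j)
      (∑ k, NormedSpace.exp (t • R) i k * R k j) t := by
  have h := hasDerivAt_exp_smul_const (𝕂 := ℝ) R t
  have := (hasDerivAt_pi.1 ((hasDerivAt_pi.1 h) i)) j
  rw [← Matrix.mul_apply]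
  exact this

theorem continuous_exp_smul_apply (R : Matrix (Fin n) (Fin n) ℝ) (i j : Fin n) :
    Continuous (fun s : ℝ => NormedSpace.exp (s • R) i j) :=
  continuous_iff_continuousAt.2 fun t => (hasDerivAt_exp_smul_apply R t i j).continuousAt

theorem integrableOn_exp_mul_exp_smul_apply {R : Matrix (Fin n) (Fin n) ℝ}
    (hR : ∀ t : ℝ, 0 ≤ t → ∀ i j, |NormedSpace.exp (t • R) i j| ≤ 1) {h : ℝ} (hh : 0 < h)
    (i j : Fin n) :
    IntegrableOn (fun t : ℝ => Real.exp (-h * t) * NormedSpace.exp (t • R) i j) (Ioi 0) := by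
  refine Integrable.mono' (integrableOn_exp_mul_Ioi (neg_lt_zero.2 hh) 0) ?_ ?_
  · exact ((by fun_prop : Continuous fun t : ℝ => Real.exp (-h * t)).mul
      (continuous_exp_smul_apply R i j)).aestronglyMeasurable
  · refine (ae_restrict_iff' measurableSet_Ioi).2 (ae_of_all _ fun t ht => ?_)
    rw [norm_mul, Real.norm_of_nonneg (Real.exp_pos _).le]
    exact mul_le_of_le_one_right (Real.exp_pos _).le (hR t (le_of_lt ht) i j)

/-- The Laplace transform of the semigroup generated by `R` is the resolvent of `R`. -/
theorem sum_integral_exp_smul_mul_resolvent {R : Matrix (Fin n) (Fin n) ℝ}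
    (hR : ∀ t : ℝ, 0 ≤ t → ∀ i j, |NormedSpace.exp (t • R) i j| ≤ 1) {h : ℝ} (hh : 0 < h)
    (i k : Fin n) :
    ∑ j, (∫ t in Ioi (0 : ℝ), Real.exp (-h * t) * NormedSpace.exp (t • R) i j) *
      ((if j = k then h else 0) - R j k) = if i = k then 1 else 0 := by
  have hint := integrableOn_exp_mul_exp_smul_apply hR hh
  -- The integrand e^{-ht} exp(tR)(h - R) is the derivative of -e^{-ht} exp(tR), which rises from -1
  -- at time 0 to 0 at infinity.
  have hderiv : ∀ t ∈ Ici (0 : ℝ),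
      HasDerivAt (fun t : ℝ => -(Real.exp (-h * t) * NormedSpace.exp (t • R) i k))
      (∑ j, Real.exp (-h * t) * NormedSpace.exp (t • R) i j *
        ((if j = k then h else 0) - R j k)) t := by
    intro t _
    have h1 : HasDerivAt (fun t : ℝ => Real.exp (-h * t)) (Real.exp (-h * t) * (-h)) t := by
      simpa using ((hasDerivAt_id t).const_mul (-h)).exp
    refine (h1.mul (hasDerivAt_exp_smul_apply R t i k)).neg.congr_deriv ?_
    simp only [mul_sub, Finset.sum_sub_distrib, mul_ite, mul_zero, Finset.sum_ite_eq',
      Finset.mem_univ, if_true, Finset.mul_sum]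
    rw [neg_add, sub_eq_add_neg]
    congr 1
    · ring
    · simp [mul_assoc]
  have hint' : IntegrableOn (fun t : ℝ => ∑ j, Real.exp (-h * t) * NormedSpace.exp (t • R) i j *
        ((if j = k then h else 0) - R j k)) (Ioi 0) :=
    integrable_finsetSum _ fun j _ => (hint i j).mul_const _
  have hlim : Tendsto (fun t : ℝ => -(Real.exp (-h * t) * NormedSpace.exp (t • R) i k))
      atTop (𝓝 0) := by
    have hexp : Tendsto (fun t : ℝ => Real.exp (-h * t)) atTop (𝓝 0) :=
      Real.tendsto_exp_atBot.comp (tendsto_id.const_mul_atTop_of_neg (neg_lt_zero.2 hh))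
    refine squeeze_zero_norm' ?_ hexp
    filter_upwards [eventually_ge_atTop (0 : ℝ)] with t ht
    rw [norm_neg, norm_mul, Real.norm_of_nonneg (Real.exp_pos _).le]
    exact mul_le_of_le_one_right (Real.exp_pos _).le (hR t ht i k)
  have := integral_Ioi_of_hasDerivAt_of_tendsto' hderiv hint' hlim
  rw [integral_finsetSum _ fun j _ => (hint i j).mul_const _] at this
  simp only [integral_mul_const] at this
  rw [this]
  simp [Matrix.one_apply]

end MatrixExp

/-! ### Calculus on the closed orthant. -/

section Orthant

variable {n : ℕ}

theorem orthant_eq_pi (n : ℕ) : orthant n = Set.univ.pi fun _ => Ici (0 : ℝ) := by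
  ext l; simp only [orthant, Set.mem_ofPred_eq, Set.mem_univ_pi, mem_Ici]

theorem uniqueDiffOn_orthant (n : ℕ) : UniqueDiffOn ℝ (orthant n) := by
  rw [orthant_eq_pi]
  exact UniqueDiffOn.univ_pi fun _ => uniqueDiffOn_Ici 0

theorem add_mem_orthant {l l' : Fin n → ℝ} (hl : l ∈ orthant n) (hl' : l' ∈ orthant n) :
    l + l' ∈ orthant n := fun i => add_nonneg (hl i) (hl' i)

theorem shiftedSq_mem_orthant (r : ℝ) (φ : Fin n → ℂ) : shiftedSq r φ ∈ orthant n :=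
  fun i => by simp only [shiftedSq]; positivity

theorem continuous_shiftedSq (r : ℝ) : Continuous (shiftedSq (n := n) r) := by
  unfold shiftedSq; fun_prop

/-- The partial derivative `∂_i u` of a function on the closed orthant. -/
noncomputable def partialDeriv (u : (Fin n → ℝ) → ℂ) (i : Fin n) (l : Fin n → ℝ) : ℂ :=
  fderivWithin ℝ u (orthant n) l (Pi.single i 1)

theorem fderivWithin_single (u : (Fin n → ℝ) → ℂ) (i : Fin n) (l : Fin n → ℝ) (c : ℝ) :
    fderivWithin ℝ u (orthant n) l (Pi.single i c) = c * partialDeriv u i l := by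
  have : Pi.single i c = c • (Pi.single i 1 : Fin n → ℝ) := by
    rw [← Pi.single_smul]; simp
  rw [this, map_smul, partialDeriv, Complex.real_smul]

namespace PropertyF

variable {u : (Fin n → ℝ) → ℂ}

theorem continuousOn (hu : PropertyF u) : ContinuousOn u (orthant n) := hu.smooth.continuousOn

/-- Derivatives are taken within the orthant because |φ + √r 𝟏|² and local times reach its boundary.
The chain rule still applies to curves that stay inside. -/
theorem hasFDerivWithinAt (hu : PropertyF u) {l : Fin n → ℝ} (hl : l ∈ orthant n) :
    HasFDerivWithinAt u (fderivWithin ℝ u (orthant n) l) (orthant n) l :=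
  (hu.smooth.differentiableOn (by simp) l hl).hasFDerivWithinAt

theorem continuousOn_partialDeriv (hu : PropertyF u) (i : Fin n) :
    ContinuousOn (partialDeriv u i) (orthant n) :=
  (hu.smooth.continuousOn_fderivWithin (uniqueDiffOn_orthant n) (by exact_mod_cast le_top)).clm_apply
    continuousOn_const

/-- Bounds on u and its first partial derivatives suffice for every integrability claim: the
Gaussian weight controls φ, and the exponential law controls time. -/
theorem exists_bound (hu : PropertyF u) : ∃ C, 0 ≤ C ∧ ∀ l ∈ orthant n, ‖u l‖ ≤ C := by
  obtain ⟨C, hC⟩ := hu.decay 0 0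
  refine ⟨|C|, abs_nonneg C, fun l hl => (le_trans ?_ (hC l hl)).trans (le_abs_self C)⟩
  simp

theorem exists_bound_partialDeriv (hu : PropertyF u) :
    ∃ C, 0 ≤ C ∧ ∀ i, ∀ l ∈ orthant n, ‖partialDeriv u i l‖ ≤ C := by
  obtain ⟨C, hC⟩ := hu.decay 1 0
  refine ⟨|C|, abs_nonneg C, fun i l hl => ?_⟩
  have h1 := hC l hl
  rw [pow_zero, one_mul, norm_iteratedFDerivWithin_one _ (uniqueDiffOn_orthant n l hl)] at h1
  calc ‖partialDeriv u i l‖ ≤ ‖fderivWithin ℝ u (orthant n) l‖ * ‖(Pi.single i 1 : Fin n → ℝ)‖ :=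
        ContinuousLinearMap.le_opNorm _ _
    _ ≤ |C| := by rw [Pi.norm_single, norm_one, mul_one]; exact h1.trans (le_abs_self C)

end PropertyF
end Orthant

/-! ### Integrability against the twisted Gaussian weight. -/

section Gaussian

variable {n : ℕ} {Q : Matrix (Fin n) (Fin n) ℝ} {h : ℝ}

/-- The unnormalized density `exp ⟨φ, Q_h φ̄⟩` of the twisted Gaussian measure. -/
noncomputable def gaussianWeight (Q : Matrix (Fin n) (Fin n) ℝ) (h : ℝ) (φ : Fin n → ℂ) : ℂ :=
  Complex.exp (∑ i, ∑ j, φ i * (killedLaplacian Q (fun _ => h) i j : ℂ) * conj (φ j))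

theorem continuous_gaussianWeight : Continuous (gaussianWeight Q h) := by
  unfold gaussianWeight; fun_prop

/-- The real part of the Q form is nonpositive, so the killing term alone gives a product Gaussian
bound. -/
theorem norm_gaussianWeight_le (hQ : IsIrreducibleLaplacian Q) (φ : Fin n → ℂ) :
    ‖gaussianWeight Q h φ‖ ≤ ∏ i, Real.exp (-h * ‖φ i‖ ^ 2) := by
  rw [gaussianWeight, Complex.norm_exp, ← Real.exp_sum]
  apply Real.exp_le_exp.2
  have h1 : (∑ i, ∑ j, φ i * (killedLaplacian Q (fun _ => h) i j : ℂ) * conj (φ j)) =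
      (∑ i, ∑ j, φ i * (Q i j : ℂ) * conj (φ j)) + ∑ i, ((-h * ‖φ i‖ ^ 2 : ℝ) : ℂ) := by
    rw [← Finset.sum_add_distrib]
    refine Finset.sum_congr rfl fun i _ => ?_
    have : ((-h * ‖φ i‖ ^ 2 : ℝ) : ℂ) =
        ∑ j, φ i * ((-(Matrix.diagonal (fun _ => h) i j) : ℝ) : ℂ) * conj (φ j) := by
      simp only [Matrix.diagonal_apply]
      rw [Finset.sum_eq_single i]
      · simp [Complex.ofReal_neg]
        rw [← Complex.conj_mul' (φ i)]; ring
      · intro j _ hj; simp [Ne.symm hj]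
      · simp
    rw [this, ← Finset.sum_add_distrib]
    refine Finset.sum_congr rfl fun j _ => ?_
    simp only [killedLaplacian, Matrix.sub_apply]
    push_cast; ring
  rw [h1, Complex.add_re]
  have h2 := hQ.re_sum_nonpos φ
  rw [← Complex.ofReal_sum, Complex.ofReal_re]
  linarith

theorem one_add_norm_le_prod (φ : Fin n → ℂ) : 1 + ‖φ‖ ≤ ∏ i, (1 + ‖φ i‖) := by
  have h1 : 1 ≤ ∏ i, (1 + ‖φ i‖) := Finset.one_le_prod fun i _ => by simp
  have h2 : ‖φ‖ ≤ ∏ i, (1 + ‖φ i‖) - 1 := by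
    refine (pi_norm_le_iff_of_nonneg (by linarith)).2 fun i => ?_
    have := Finset.prod_le_prod_of_subset_of_one_le (f := fun i => 1 + ‖φ i‖)
      (Finset.subset_univ {i}) (fun _ _ => by positivity) (fun _ _ _ => by simp)
    rw [Finset.prod_singleton] at this
    linarith
  linarith

theorem integrable_one_add_norm_mul_gaussian (hh : 0 < h) :
    Integrable fun z : ℂ => (1 + ‖z‖) * Real.exp (-h * ‖z‖ ^ 2) := by
  have hg : Integrable fun z : ℂ => Real.exp (-(h / 2) * ‖z‖ ^ 2) := by
    have := (GaussianFourier.integrable_cexp_neg_mul_sq_norm_add (V := ℂ) (b := ((h / 2 : ℝ) : ℂ))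
      (by rw [Complex.ofReal_re]; positivity) 0 0).norm
    refine this.congr (ae_of_all _ fun z => ?_)
    simp only [Complex.norm_exp, zero_mul, add_zero]
    congr 1
    rw [← Complex.ofReal_neg, ← Complex.ofReal_pow, ← Complex.ofReal_mul, Complex.ofReal_re]
  refine (hg.const_mul (2 + 2 / h)).mono' (by fun_prop) (ae_of_all _ fun z => ?_)
  rw [Real.norm_of_nonneg (by positivity)]
  have h1 : Real.exp (-h * ‖z‖ ^ 2) =
      Real.exp (-(h / 2) * ‖z‖ ^ 2) * Real.exp (-(h / 2 * ‖z‖ ^ 2)) := by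
    rw [← Real.exp_add]; ring_nf
  -- Half of the Gaussian exponent absorbs the linear factor. By eˣ ≥ 1 + x, the constant 2 + 2/h
  -- makes the right side at least ‖z‖² + 2.
  have h2 : (1 + ‖z‖) ≤ (2 + 2 / h) * Real.exp (h / 2 * ‖z‖ ^ 2) := by
    have h3 : h / 2 * ‖z‖ ^ 2 + 1 ≤ Real.exp (h / 2 * ‖z‖ ^ 2) := Real.add_one_le_exp _
    have h4 : (2 + 2 / h) * (h / 2 * ‖z‖ ^ 2 + 1) = h * ‖z‖ ^ 2 + ‖z‖ ^ 2 + 2 + 2 / h := by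
      field_simp; ring
    have h5 : (2 + 2 / h) * (h / 2 * ‖z‖ ^ 2 + 1) ≤ (2 + 2 / h) * Real.exp (h / 2 * ‖z‖ ^ 2) :=
      mul_le_mul_of_nonneg_left h3 (by positivity)
    have h6 : 0 ≤ h * ‖z‖ ^ 2 := by positivity
    have h7 : 0 ≤ 2 / h := by positivity
    nlinarith [sq_nonneg (‖z‖ - 1)]
  rw [h1]
  calc (1 + ‖z‖) * (Real.exp (-(h / 2) * ‖z‖ ^ 2) * Real.exp (-(h / 2 * ‖z‖ ^ 2)))
      ≤ ((2 + 2 / h) * Real.exp (h / 2 * ‖z‖ ^ 2)) *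
        (Real.exp (-(h / 2) * ‖z‖ ^ 2) * Real.exp (-(h / 2 * ‖z‖ ^ 2))) := by gcongr
    _ = (2 + 2 / h) * Real.exp (-(h / 2) * ‖z‖ ^ 2) *
        (Real.exp (h / 2 * ‖z‖ ^ 2) * Real.exp (-(h / 2 * ‖z‖ ^ 2))) := by ring
    _ = _ := by rw [← Real.exp_add]; simp

theorem integrable_one_add_norm_mul_gaussianWeight (hQ : IsIrreducibleLaplacian Q) (hh : 0 < h) :
    Integrable fun φ : Fin n → ℂ => (1 + ‖φ‖) * ‖gaussianWeight Q h φ‖ := by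
  have h1 : Integrable fun φ : Fin n → ℂ =>
      ∏ i, (1 + ‖φ i‖) * Real.exp (-h * ‖φ i‖ ^ 2) :=
    Integrable.fintype_prod fun _ => integrable_one_add_norm_mul_gaussian hh
  refine h1.mono' ?_ (ae_of_all _ fun φ => ?_)
  · have := continuous_gaussianWeight (Q := Q) (h := h)
    exact Continuous.aestronglyMeasurable (by fun_prop)
  · rw [Real.norm_of_nonneg (by positivity), Finset.prod_mul_distrib]
    gcongr
    · exact one_add_norm_le_prod φ
    · exact norm_gaussianWeight_le hQ φ

/-- Functions of at most linear growth are integrable against the twisted Gaussian weight. -/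
theorem integrable_mul_gaussianWeight (hQ : IsIrreducibleLaplacian Q) (hh : 0 < h)
    {F : (Fin n → ℂ) → ℂ} (hF : AEStronglyMeasurable F) {C : ℝ}
    (hC : ∀ φ, ‖F φ‖ ≤ C * (1 + ‖φ‖)) :
    Integrable fun φ => F φ * gaussianWeight Q h φ := by
  refine ((integrable_one_add_norm_mul_gaussianWeight hQ hh).const_mul C).mono'
    (hF.mul continuous_gaussianWeight.aestronglyMeasurable) (ae_of_all _ fun φ => ?_)
  rw [norm_mul, ← mul_assoc]
  gcongr
  exact hC φ

end Gaussian

/-! ### Integration by parts in the complex coordinates. -/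

section IntegrationByParts

variable {n : ℕ} {Q : Matrix (Fin n) (Fin n) ℝ} {h : ℝ}

/-- The exponent is not holomorphic, so a real directional derivative involves both v and its
conjugate. Directions 1 and i are combined afterwards into ∂/∂φ̄. -/
theorem hasLineDerivAt_gaussianWeight (φ v : Fin n → ℂ) :
    HasLineDerivAt ℝ (gaussianWeight Q h)
      ((∑ i, ∑ j, (v i * (killedLaplacian Q (fun _ => h) i j : ℂ) * conj (φ j) +
        φ i * (killedLaplacian Q (fun _ => h) i j : ℂ) * conj (v j))) * gaussianWeight Q h φ)
      φ v := by
  unfold HasLineDerivAt gaussianWeight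
  have hl : ∀ i, HasDerivAt (fun t : ℝ => (φ + t • v) i) (v i) 0 := fun i => by
    have := ((hasDerivAt_id (0 : ℝ)).smul_const (v i)).const_add (φ i)
    simpa using this
  have hc : ∀ j, HasDerivAt (fun t : ℝ => conj ((φ + t • v) j)) (conj (v j)) 0 := fun j =>
    (hl j).star
  have hsum : HasDerivAt (fun t : ℝ => ∑ i, ∑ j, (φ + t • v) i *
      (killedLaplacian Q (fun _ => h) i j : ℂ) * conj ((φ + t • v) j))
      (∑ i, ∑ j, (v i * (killedLaplacian Q (fun _ => h) i j : ℂ) * conj (φ j) +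
        φ i * (killedLaplacian Q (fun _ => h) i j : ℂ) * conj (v j))) 0 := by
    refine HasDerivAt.fun_sum fun i _ => HasDerivAt.fun_sum fun j _ => ?_
    exact (((hl i).mul_const _).mul (hc j)).congr_deriv (by simp)
  have := hsum.cexp
  simpa [mul_comm] using this

/-- Moving φ along coordinate x changes only the x-th square, and the resulting curve never leaves
the orthant, so the derivative within it suffices. -/
theorem hasLineDerivAt_comp_shiftedSq {u : (Fin n → ℝ) → ℂ} (hu : PropertyF u) (r : ℝ)
    {l : Fin n → ℝ} (hl : l ∈ orthant n) (φ : Fin n → ℂ) (x : Fin n) (c : ℂ) :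
    HasLineDerivAt ℝ (fun φ => u (shiftedSq r φ + l))
      (((2 * ((φ x + (Real.sqrt r : ℂ)) * conj c).re : ℝ) : ℂ) *
        partialDeriv u x (shiftedSq r φ + l)) φ (Pi.single x c) := by
  unfold HasLineDerivAt
  rw [← fderivWithin_single]
  have hmem : ∀ φ, shiftedSq r φ + l ∈ orthant n := fun φ =>
    add_mem_orthant (shiftedSq_mem_orthant r φ) hl
  have hg : HasDerivAt (fun t : ℝ => shiftedSq r (φ + t • (Pi.single x c : Fin n → ℂ)) + l)
      (Pi.single x (2 * ((φ x + (Real.sqrt r : ℂ)) * conj c).re)) 0 := by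
    refine HasDerivAt.add_const _ (hasDerivAt_pi.2 fun i => ?_)
    by_cases hi : i = x
    · subst hi
      have h1 : HasDerivAt (fun t : ℝ => (φ + t • (Pi.single i c : Fin n → ℂ)) i + (Real.sqrt r : ℂ))
          c 0 := by
        have := (((hasDerivAt_id (0 : ℝ)).smul_const c).const_add (φ i)).add_const (Real.sqrt r : ℂ)
        simpa using this
      have := h1.norm_sq
      simp only [shiftedSq]
      refine this.congr_deriv ?_
      simp [Complex.inner]
      ring
    · simp only [shiftedSq]
      simp [hi, hasDerivAt_const]
  have hf := hu.hasFDerivWithinAt (hmem φ)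
  have hf' : HasFDerivWithinAt u (fderivWithin ℝ u (orthant n) (shiftedSq r φ + l)) (orthant n)
      ((fun t : ℝ => shiftedSq r (φ + t • (Pi.single x c : Fin n → ℂ)) + l) 0) := by simpa using hf
  exact hf'.comp_hasDerivAt 0 hg (Eventually.of_forall fun t => hmem _)

/-- Integration by parts for the operator `∂/∂φ̄_x` against the twisted Gaussian weight. -/
theorem integral_wirtinger_eq_zero (hQ : IsIrreducibleLaplacian Q) (hh : 0 < h)
    {u : (Fin n → ℝ) → ℂ} (hu : PropertyF u) (r : ℝ)
    {l : Fin n → ℝ} (hl : l ∈ orthant n) (x : Fin n) :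
    ∫ φ : Fin n → ℂ, ((∑ i, φ i * (killedLaplacian Q (fun _ => h) i x : ℂ)) *
        u (shiftedSq r φ + l) +
      (φ x + (Real.sqrt r : ℂ)) * partialDeriv u x (shiftedSq r φ + l)) * gaussianWeight Q h φ
      = 0 := by
  set M := killedLaplacian Q (fun _ => h) with hM
  obtain ⟨C, hC0, hC⟩ := hu.exists_bound
  obtain ⟨C', hC'0, hC'⟩ := hu.exists_bound_partialDeriv
  have hmem : ∀ φ, shiftedSq r φ + l ∈ orthant n := fun φ =>
    add_mem_orthant (shiftedSq_mem_orthant r φ) hl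
  have hS : Continuous fun φ : Fin n → ℂ => shiftedSq r φ + l :=
    (continuous_shiftedSq r).add continuous_const
  have hcu : Continuous fun φ => u (shiftedSq r φ + l) :=
    hu.continuousOn.comp_continuous hS hmem
  have hcd : Continuous fun φ => partialDeriv u x (shiftedSq r φ + l) :=
    (hu.continuousOn_partialDeriv x).comp_continuous hS hmem
  have hint0 : Integrable fun φ => u (shiftedSq r φ + l) * gaussianWeight Q h φ :=
    integrable_mul_gaussianWeight hQ hh hcu.aestronglyMeasurable (C := C) fun φ =>
      (hC _ (hmem φ)).trans (le_mul_of_one_le_right hC0 (by simp))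
  -- the coordinates of a vector `φ` and its conjugate are integrable against `u`
  have hφ : ∀ i, Integrable fun φ : Fin n → ℂ =>
      (φ i * u (shiftedSq r φ + l)) * gaussianWeight Q h φ := fun i =>
    integrable_mul_gaussianWeight hQ hh ((continuous_apply i).mul hcu).aestronglyMeasurable (C := C) fun φ => by
      rw [norm_mul, mul_comm]
      have := norm_le_pi_norm φ i
      gcongr
      · exact hC _ (hmem φ)
      · linarith
  have hφ' : ∀ i, Integrable fun φ : Fin n → ℂ =>
      (conj (φ i) * u (shiftedSq r φ + l)) * gaussianWeight Q h φ := fun i =>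
    integrable_mul_gaussianWeight hQ hh ((Complex.continuous_conj.comp (continuous_apply i)).mul hcu).aestronglyMeasurable
      (C := C) fun φ => by
      rw [norm_mul, mul_comm, RCLike.norm_conj]
      have := norm_le_pi_norm φ i
      gcongr
      · exact hC _ (hmem φ)
      · linarith
  have hd : ∀ c : ℂ, Integrable fun φ : Fin n → ℂ =>
      (((2 * ((φ x + (Real.sqrt r : ℂ)) * conj c).re : ℝ) : ℂ) *
        partialDeriv u x (shiftedSq r φ + l)) * gaussianWeight Q h φ := fun c =>
    integrable_mul_gaussianWeight hQ hh (Continuous.aestronglyMeasurable (by fun_prop))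
      (C := 2 * (1 + Real.sqrt r) * ‖c‖ * C') fun φ => by
      rw [norm_mul]
      have h1 : ‖((2 * ((φ x + (Real.sqrt r : ℂ)) * conj c).re : ℝ) : ℂ)‖ ≤
          2 * ((1 + Real.sqrt r) * (1 + ‖φ‖) * ‖c‖) := by
        rw [Complex.norm_real, norm_mul, Real.norm_two]
        gcongr
        refine (Complex.abs_re_le_norm _).trans ?_
        rw [norm_mul, RCLike.norm_conj]
        gcongr
        refine (norm_add_le _ _).trans ?_
        rw [Complex.norm_real, Real.norm_of_nonneg (Real.sqrt_nonneg r)]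
        have := norm_le_pi_norm φ x
        nlinarith [Real.sqrt_nonneg r, norm_nonneg φ]
      calc _ ≤ 2 * ((1 + Real.sqrt r) * (1 + ‖φ‖) * ‖c‖) * C' := by
            gcongr
            exact hC' x _ (hmem φ)
        _ = _ := by ring
  have hline : ∀ (φ : Fin n → ℂ) (c : ℂ),
      (∑ i, ∑ j, ((Pi.single x c : Fin n → ℂ) i * (M i j : ℂ) * conj (φ j) +
        φ i * (M i j : ℂ) * conj ((Pi.single x c : Fin n → ℂ) j))) =
      c * (∑ j, (M x j : ℂ) * conj (φ j)) + conj c * ∑ i, φ i * (M i x : ℂ) := by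
    intro φ c
    simp only [Finset.sum_add_distrib]
    congr 1
    · rw [Finset.sum_eq_single x]
      · simp [Finset.mul_sum, mul_assoc]
      · intro i _ hi; simp [hi]
      · simp
    · rw [Finset.mul_sum]
      refine Finset.sum_congr rfl fun i _ => ?_
      rw [Finset.sum_eq_single x]
      · simp; ring
      · intro j _ hj; simp [hj]
      · simp
  have hintg : ∀ c : ℂ, Integrable fun φ : Fin n → ℂ => u (shiftedSq r φ + l) *
      ((c * (∑ j, (M x j : ℂ) * conj (φ j)) + conj c * ∑ i, φ i * (M i x : ℂ)) *
        gaussianWeight Q h φ) := by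
    intro c
    have h1 := (integrable_finsetSum Finset.univ fun j _ => (hφ' j).const_mul (c * (M x j : ℂ))).add
      (integrable_finsetSum Finset.univ fun i _ => (hφ i).const_mul (conj c * (M i x : ℂ)))
    refine h1.congr (ae_of_all _ fun φ => ?_)
    simp only [Pi.add_apply, Finset.mul_sum, add_mul, mul_add, Finset.sum_mul]
    congr 1 <;> exact Finset.sum_congr rfl fun i _ => by ring
  have hibp : ∀ c : ℂ, ∫ φ : Fin n → ℂ, (u (shiftedSq r φ + l) *
      ((c * (∑ j, (M x j : ℂ) * conj (φ j)) + conj c * ∑ i, φ i * (M i x : ℂ)) *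
        gaussianWeight Q h φ) + (((2 * ((φ x + (Real.sqrt r : ℂ)) * conj c).re : ℝ) : ℂ) *
        partialDeriv u x (shiftedSq r φ + l)) * gaussianWeight Q h φ) = 0 := by
    intro c
    rw [integral_add (hintg c) (hd c)]
    have := integral_bilinear_hasLineDerivAt_right_eq_neg_left_of_integrable
      (μ := (volume : Measure (Fin n → ℂ)))
      (f := fun φ => u (shiftedSq r φ + l)) (g := gaussianWeight Q h)
      (B := ContinuousLinearMap.mul ℝ ℂ) (v := Pi.single x c)
      (hd c) (hintg c) hint0
      (fun φ _ => hasLineDerivAt_comp_shiftedSq hu r hl φ x c)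
      (fun φ _ => by
        have := hasLineDerivAt_gaussianWeight (Q := Q) (h := h) φ (Pi.single x c)
        rwa [hline] at this)
    simp only [ContinuousLinearMap.mul_apply'] at this
    rw [this, neg_add_cancel]
  -- 2 ∂/∂φ̄ is the derivative in direction 1 plus i times that in direction i: the coefficients of
  -- c add up to 1 + i·i = 0, those of conj c to 1 + i·(-i) = 2.
  have h1 := hibp 1
  have h2 := hibp Complex.I
  have h3 := integral_add ((hintg 1).add (hd 1))
    (((hintg Complex.I).add (hd Complex.I)).const_mul Complex.I)
  simp only [Pi.add_apply] at h3
  rw [integral_const_mul, h1, h2, mul_zero, add_zero] at h3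
  have h4 : ∫ φ : Fin n → ℂ, 2 * (((∑ i, φ i * (M i x : ℂ)) * u (shiftedSq r φ + l) +
      (φ x + (Real.sqrt r : ℂ)) * partialDeriv u x (shiftedSq r φ + l)) *
      gaussianWeight Q h φ) = 0 := by
    rw [← h3]
    refine integral_congr_ae (ae_of_all _ fun φ => ?_)
    have hz : ((2 * ((φ x + (Real.sqrt r : ℂ)) * conj (1 : ℂ)).re : ℝ) : ℂ) +
        Complex.I * ((2 * ((φ x + (Real.sqrt r : ℂ)) * conj Complex.I).re : ℝ) : ℂ) =
        2 * (φ x + (Real.sqrt r : ℂ)) := by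
      apply Complex.ext <;> simp
    have hI : Complex.I * Complex.I = -1 := Complex.I_mul_I
    simp only
    rw [map_one, one_mul, one_mul, Complex.conj_I] at *
    linear_combination (-(u (shiftedSq r φ + l)) * gaussianWeight Q h φ *
      ((∑ j, (M x j : ℂ) * conj (φ j)) - ∑ i, φ i * (M i x : ℂ))) * hI -
      partialDeriv u x (shiftedSq r φ + l) * gaussianWeight Q h φ * hz
  rw [integral_const_mul] at h4
  simpa using h4

end IntegrationByParts

/-! ### Measurability of path functionals and calculus along local time. -/

section Paths

variable {n : ℕ}

theorem measurable_comp_of_continuousOn_orthant {α : Type*} [MeasurableSpace α]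
    {v : (Fin n → ℝ) → ℂ} (hv : ContinuousOn v (orthant n)) {Z : α → Fin n → ℝ}
    (hZ : Measurable Z) (hmem : ∀ a, Z a ∈ orthant n) : Measurable fun a => v (Z a) :=
  (continuousOn_iff_continuous_domRestrict.1 hv).measurable.comp (hZ.subtype_mk (h := hmem))

/-- The first point of the grid `(m + 1)⁻¹ ℕ` strictly to the right of `t`. -/
noncomputable def gridTime (m : ℕ) (t : ℝ) : ℝ≥0 :=
  ((⌊t * (m + 1)⌋₊ + 1 : ℕ) : ℝ≥0) / (m + 1)

theorem lt_gridTime (m : ℕ) (t : ℝ) : t < gridTime m t := by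
  have hm : (0 : ℝ) < m + 1 := by positivity
  simp only [gridTime, NNReal.coe_div, NNReal.coe_natCast, NNReal.coe_add, NNReal.coe_one]
  rw [lt_div_iff₀ hm]
  push_cast
  exact Nat.lt_floor_add_one _

theorem gridTime_le (m : ℕ) {t : ℝ} (ht : 0 ≤ t) : gridTime m t ≤ t + 1 / (m + 1) := by
  have hm : (0 : ℝ) < m + 1 := by positivity
  simp only [gridTime, NNReal.coe_div, NNReal.coe_natCast, NNReal.coe_add, NNReal.coe_one]
  rw [div_le_iff₀ hm, add_mul, one_div, inv_mul_cancel₀ hm.ne']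
  push_cast
  have := Nat.floor_le (mul_nonneg ht hm.le)
  linarith

/-- Approaching t from the right lets right-continuity recover the state at t from countably many
grid times. -/
theorem tendsto_gridTime {t : ℝ} (ht : 0 ≤ t) :
    Tendsto (fun m => gridTime m t) atTop (𝓝[≥] t.toNNReal) := by
  refine tendsto_nhdsWithin_iff.2 ⟨?_, Eventually.of_forall fun m => ?_⟩
  · rw [← NNReal.tendsto_coe, Real.coe_toNNReal t ht]
    have h1 : Tendsto (fun m : ℕ => t + 1 / ((m : ℝ) + 1)) atTop (𝓝 t) := by
      simpa using (tendsto_one_div_add_atTop_nhds_zero_nat (𝕜 := ℝ)).const_add t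
    exact tendsto_of_tendsto_of_tendsto_of_le_of_le tendsto_const_nhds h1
      (fun m => (lt_gridTime m t).le) (fun m => gridTime_le m ht)
  · exact Real.toNNReal_le_iff_le_coe.2 (lt_gridTime m t).le

/-- The pairs `(p, t)` of a path and a time such that `p` is in state `x` immediately after `t`. -/
def stateSet (x : Fin n) : Set ((ℝ≥0 → Fin n) × ℝ) :=
  {q | ∀ᶠ m in atTop, q.1 (gridTime m q.2) = x}

/-- Evaluation is not jointly measurable on the space of all paths, but here the time takes
countably many values. -/
theorem measurable_apply_gridTime (m : ℕ) :
    Measurable fun q : (ℝ≥0 → Fin n) × ℝ => q.1 (gridTime m q.2) := by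
  have h1 : Measurable fun q : (ℝ≥0 → Fin n) × ℕ =>
      q.1 (((q.2 + 1 : ℕ) : ℝ≥0) / (m + 1)) :=
    measurable_from_prod_countable_left fun k => measurable_pi_apply (((k + 1 : ℕ) : ℝ≥0) / (m + 1))
  exact h1.comp (measurable_fst.prodMk
    (Nat.measurable_floor.comp (measurable_snd.mul_const _)))

theorem measurableSet_stateSet (x : Fin n) : MeasurableSet (stateSet x) := by
  have : stateSet x = ⋃ N : ℕ, ⋂ m : ℕ, ⋂ _ : N ≤ m,
      {q : (ℝ≥0 → Fin n) × ℝ | q.1 (gridTime m q.2) = x} := by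
    ext q; simp [stateSet, eventually_atTop]
  rw [this]
  exact MeasurableSet.iUnion fun N => MeasurableSet.iInter fun m => MeasurableSet.iInter fun _ =>
    measurable_apply_gridTime m (measurableSet_singleton x)

/-- The indicator function of the event that a path is in state `x` at time `t`. -/
noncomputable def stateInd (x : Fin n) (q : (ℝ≥0 → Fin n) × ℝ) : ℂ :=
  (stateSet x).indicator (fun _ => 1) q

theorem measurable_stateInd (x : Fin n) : Measurable (stateInd x) :=
  measurable_const.indicator (measurableSet_stateSet x)

theorem norm_stateInd_le (x : Fin n) (q : (ℝ≥0 → Fin n) × ℝ) : ‖stateInd x q‖ ≤ 1 := by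
  classical
  rw [stateInd, indicator_apply]; split_ifs <;> simp

/-- The paths that are right-continuous for the discrete topology on the state space. -/
def IsRightContinuous (p : ℝ≥0 → Fin n) : Prop := ∀ t, ContinuousWithinAt p (Set.Ici t) t

theorem IsRightContinuous.eventually_eq {p : ℝ≥0 → Fin n} (hp : IsRightContinuous p) (t : ℝ≥0) :
    ∀ᶠ s in 𝓝[≥] t, p s = p t := by
  have := hp t
  rw [ContinuousWithinAt, nhds_discrete, tendsto_pure] at this
  exact this

theorem IsRightContinuous.mem_stateSet {p : ℝ≥0 → Fin n} (hp : IsRightContinuous p) {t : ℝ}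
    (ht : 0 ≤ t) (x : Fin n) : (p, t) ∈ stateSet x ↔ p t.toNNReal = x := by
  have h1 := (tendsto_gridTime ht).eventually (hp.eventually_eq t.toNNReal)
  constructor
  · intro h2
    obtain ⟨m, hm1, hm2⟩ := (h1.and h2).exists
    exact hm1.symm.trans hm2
  · intro h2
    filter_upwards [h1] with m hm
    rw [hm, h2]

theorem IsRightContinuous.stateInd_eq {p : ℝ≥0 → Fin n} (hp : IsRightContinuous p) {t : ℝ}
    (ht : 0 ≤ t) (x : Fin n) : stateInd x (p, t) = if p t.toNNReal = x then 1 else 0 := by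
  classical
  simp only [stateInd, indicator_apply, hp.mem_stateSet ht]

/-- The local time at `t` of a path `p`, as a function of `(p, t)`. -/
noncomputable def pathLocalTime (q : (ℝ≥0 → Fin n) × ℝ) : Fin n → ℝ :=
  fun i => ∫ s in Ioc 0 q.2, (stateSet i).indicator (fun _ => (1 : ℝ)) (q.1, s)

theorem pathLocalTime_mem_orthant (q : (ℝ≥0 → Fin n) × ℝ) : pathLocalTime q ∈ orthant n :=
  fun _ => integral_nonneg fun _ => indicator_nonneg (fun _ _ => zero_le_one) _

/-- Joint measurability on paths × times is needed because independence of X and ζ enters through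
the product of their laws on that space. -/
theorem measurable_pathLocalTime : Measurable (pathLocalTime (n := n)) := by
  refine measurable_pi_lambda _ fun i => ?_
  have hset : MeasurableSet {z : ((ℝ≥0 → Fin n) × ℝ) × ℝ |
      (0 < z.2 ∧ z.2 ≤ z.1.2) ∧ (z.1.1, z.2) ∈ stateSet i} := by
    refine MeasurableSet.inter (MeasurableSet.inter ?_ ?_) ?_
    · exact measurableSet_lt measurable_const measurable_snd
    · exact measurableSet_le measurable_snd measurable_fst.snd
    · exact (measurable_fst.fst.prodMk measurable_snd) (measurableSet_stateSet i)
  have h1 : StronglyMeasurable (indicator {z : ((ℝ≥0 → Fin n) × ℝ) × ℝ |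
      (0 < z.2 ∧ z.2 ≤ z.1.2) ∧ (z.1.1, z.2) ∈ stateSet i} fun _ => (1 : ℝ)) :=
    stronglyMeasurable_const.indicator hset
  have h2 := (h1.integral_prod_right' (ν := (volume : Measure ℝ))).measurable
  convert h2 using 2 with q
  rw [pathLocalTime, ← integral_indicator measurableSet_Ioc]
  congr 1 with s
  classical
  simp only [indicator_apply, mem_Ioc, Set.mem_ofPred_eq]
  by_cases h3 : 0 < s ∧ s ≤ q.2 <;> simp [h3]

variable {p : ℝ≥0 → Fin n}

/-- The indicator function of the times at which the path `p` is in state `i`. -/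
noncomputable def occupation (p : ℝ≥0 → Fin n) (i : Fin n) (s : ℝ) : ℝ :=
  if p s.toNNReal = i then 1 else 0

theorem norm_occupation_le (p : ℝ≥0 → Fin n) (i : Fin n) (s : ℝ) : ‖occupation p i s‖ ≤ 1 := by
  unfold occupation; split_ifs <;> simp

theorem IsRightContinuous.occupation_eq (hp : IsRightContinuous p) (i : Fin n) {s : ℝ}
    (hs : 0 ≤ s) : (stateSet i).indicator (fun _ => (1 : ℝ)) (p, s) = occupation p i s := by
  classical
  simp only [occupation, indicator_apply, hp.mem_stateSet hs]

theorem IsRightContinuous.measurable_occupation (hp : IsRightContinuous p) (i : Fin n) :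
    Measurable (occupation p i) := by
  -- The time is clamped at 0, as `Real.toNNReal` does, since `occupation_eq` covers nonnegative
  -- times only.
  have h1 : Measurable fun s : ℝ => (stateSet i).indicator (fun _ => (1 : ℝ)) (p, max s 0) :=
    (measurable_const.indicator (measurableSet_stateSet i)).comp
      (measurable_const.prodMk (measurable_id.max measurable_const))
  convert h1 using 2 with s
  rw [hp.occupation_eq i (le_max_right s 0)]
  simp only [occupation]
  rcases le_total 0 s with hs | hs
  · rw [max_eq_left hs]
  · rw [max_eq_right hs, Real.toNNReal_of_nonpos hs, Real.toNNReal_zero]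

theorem IsRightContinuous.intervalIntegrable_occupation (hp : IsRightContinuous p) (i : Fin n)
    (a b : ℝ) : IntervalIntegrable (occupation p i) volume a b :=
  (intervalIntegrable_const (c := (1 : ℝ))).mono_fun
    (hp.measurable_occupation i).aestronglyMeasurable
    (ae_of_all _ fun s => by simpa using norm_occupation_le p i s)

theorem IsRightContinuous.pathLocalTime_apply (hp : IsRightContinuous p) {t : ℝ} (ht : 0 ≤ t)
    (i : Fin n) : pathLocalTime (p, t) i = ∫ s in (0 : ℝ)..t, occupation p i s := by
  rw [intervalIntegral.integral_of_le ht, pathLocalTime]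
  exact setIntegral_congr_fun measurableSet_Ioc fun s hs => hp.occupation_eq i hs.1.le

theorem IsRightContinuous.continuousWithinAt_occupation (hp : IsRightContinuous p) (i : Fin n)
    (t : ℝ) : ContinuousWithinAt (occupation p i) (Ici t) t := by
  have h1 : Tendsto Real.toNNReal (𝓝[≥] t) (𝓝[≥] t.toNNReal) :=
    tendsto_nhdsWithin_iff.2 ⟨(continuous_real_toNNReal.tendsto t).mono_left nhdsWithin_le_nhds,
      eventually_nhdsWithin_of_forall fun s hs => Real.toNNReal_le_toNNReal hs⟩
  refine Tendsto.congr' ?_ tendsto_const_nhds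
  filter_upwards [h1.eventually (hp.eventually_eq t.toNNReal)] with s hs
  simp [occupation, hs]

/-- At a jump time only the right derivative is available; the fundamental theorem of calculus for
right derivatives needs no more. -/
theorem IsRightContinuous.hasDerivWithinAt_pathLocalTime (hp : IsRightContinuous p) {t : ℝ}
    (ht : 0 ≤ t) : HasDerivWithinAt (fun t => pathLocalTime (p, t))
      (Pi.single (p t.toNNReal) 1) (Ici t) t := by
  refine hasDerivWithinAt_pi.2 fun i => ?_
  have h1 : HasDerivWithinAt (fun t => ∫ s in (0 : ℝ)..t, occupation p i s)
      (occupation p i t) (Ici t) t :=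
    intervalIntegral.integral_hasDerivWithinAt_right (t := Ioi t)
      (hp.intervalIntegrable_occupation i 0 t)
      ((hp.measurable_occupation i).stronglyMeasurable.stronglyMeasurableAtFilter)
      ((hp.continuousWithinAt_occupation i t).mono Ioi_subset_Ici_self)
  have h2 : occupation p i t = (Pi.single (p t.toNNReal) 1 : Fin n → ℝ) i := by
    simp only [occupation, Pi.single_apply, eq_comm]
  rw [← h2]
  exact h1.congr (fun s hs => hp.pathLocalTime_apply (ht.trans hs) i) (hp.pathLocalTime_apply ht i)

theorem IsRightContinuous.continuousOn_pathLocalTime (hp : IsRightContinuous p) :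
    ContinuousOn (fun t => pathLocalTime (p, t)) (Ici 0) := by
  refine continuousOn_pi.2 fun i => ?_
  have h1 : Continuous fun t : ℝ => ∫ s in (0 : ℝ)..t, occupation p i s :=
    intervalIntegral.continuous_primitive (hp.intervalIntegrable_occupation i) 0
  exact h1.continuousOn.congr fun t ht => hp.pathLocalTime_apply ht i

theorem pathLocalTime_zero (p : ℝ≥0 → Fin n) : pathLocalTime (p, 0) = 0 := by
  ext i; simp [pathLocalTime]

/-- The fundamental theorem of calculus along the local time of a right-continuous path. -/
theorem IsRightContinuous.comp_pathLocalTime_eq (hp : IsRightContinuous p)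
    {u : (Fin n → ℝ) → ℂ} (hu : PropertyF u) {l : Fin n → ℝ} (hl : l ∈ orthant n) {t : ℝ}
    (ht : 0 ≤ t) : u (l + pathLocalTime (p, t)) = u l + ∫ s in Ioc 0 t, ∑ y,
      partialDeriv u y (l + pathLocalTime (p, s)) *
        stateInd y (p, s) := by
  obtain ⟨C, hC0, hC⟩ := hu.exists_bound_partialDeriv
  have hmem : ∀ s, l + pathLocalTime (p, s) ∈ orthant n := fun s =>
    add_mem_orthant hl (pathLocalTime_mem_orthant _)
  have hmeasL : Measurable fun s : ℝ => l + pathLocalTime (p, s) :=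
    (measurable_pathLocalTime.comp (measurable_const.prodMk measurable_id)).const_add l
  have hder : ∀ x ∈ Ioo (min 0 t) (max 0 t),
      HasDerivWithinAt (fun s => u (l + pathLocalTime (p, s)))
      (∑ y, partialDeriv u y (l + pathLocalTime (p, x)) *
        stateInd y (p, x)) (Ioi x) x := by
    intro x hx
    have hx0 : 0 ≤ x := by
      have := hx.1; rw [min_eq_left ht] at this; exact this.le
    have h1 := ((hp.hasDerivWithinAt_pathLocalTime hx0).const_add l).mono Ioi_subset_Ici_self
    have h2 := (hu.hasFDerivWithinAt (hmem x)).comp_hasDerivWithinAt x h1 (fun s _ => hmem s)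
    refine h2.congr_deriv ?_
    rw [Finset.sum_eq_single (p x.toNNReal)]
    · simp [hp.stateInd_eq hx0, partialDeriv]
    · intro y _ hy
      simp [hp.stateInd_eq hx0, Ne.symm hy]
    · simp
  have hcont : ContinuousOn (fun s => u (l + pathLocalTime (p, s))) (uIcc 0 t) := by
    rw [uIcc_of_le ht]
    exact hu.continuousOn.comp
      ((hp.continuousOn_pathLocalTime.mono Icc_subset_Ici_self).const_add l) (fun s _ => hmem s)
  have hint : IntervalIntegrable (fun s => ∑ y, partialDeriv u y (l + pathLocalTime (p, s)) *
        stateInd y (p, s)) volume 0 t := by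
    refine (intervalIntegrable_const (c := ∑ _y : Fin n, C)).mono_fun ?_ (ae_of_all _ fun s => ?_)
    · refine Measurable.aestronglyMeasurable (Finset.measurable_sum _ fun y _ => ?_)
      exact (measurable_comp_of_continuousOn_orthant (hu.continuousOn_partialDeriv y) hmeasL
        hmem).mul ((measurable_stateInd y).comp
          (measurable_const.prodMk measurable_id))
    · rw [Real.norm_of_nonneg (Finset.sum_nonneg fun _ _ => hC0)]
      refine norm_sum_le_of_le _ fun y _ => ?_
      rw [norm_mul]
      exact (mul_le_of_le_one_right (norm_nonneg _) (norm_stateInd_le _ _)).trans (hC y _ (hmem s))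
  have := intervalIntegral.integral_eq_sub_of_hasDeriv_right hcont hder hint
  rw [intervalIntegral.integral_of_le ht] at this
  rw [this, pathLocalTime_zero, add_zero]
  ring

end Paths

/-! ### Riemann sums for local time. -/

section RiemannSum

/-- Right-endpoint Riemann sums of a bounded right-continuous function converge. -/
theorem tendsto_rightRiemannSum {g : ℝ → ℝ} {C : ℝ} (hC : ∀ r, ‖g r‖ ≤ C)
    (hr : ∀ r, ContinuousWithinAt g (Ici r) r) :
    Tendsto (fun m : ℕ => ∑ k ∈ Finset.range (m + 1),
      (1 / ((m : ℝ) + 1)) * g (((k : ℝ) + 1) / (m + 1))) atTop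
      (𝓝 (∫ r in (0 : ℝ)..1, g r)) := by
  have hgm : ∀ m : ℕ, Measurable fun r : ℝ => g (gridTime m r) := fun m => by
    have h1 : Measurable fun k : ℕ => g ((((k + 1 : ℕ) : ℝ≥0) / (m + 1) : ℝ≥0) : ℝ) :=
      measurable_from_nat
    exact h1.comp (Nat.measurable_floor.comp (measurable_id.mul_const _))
  have hii : ∀ (m : ℕ) (a b : ℝ), IntervalIntegrable (fun r => g (gridTime m r)) volume a b :=
    fun m a b => (intervalIntegrable_const (c := C)).mono_fun (hgm m).aestronglyMeasurable
      (ae_of_all _ fun s => (hC _).trans (le_abs_self C))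
  -- On the interior of each cell the grid time is the right endpoint, so the sum is exactly an
  -- integral and dominated convergence applies.
  have hsum : ∀ m : ℕ, ∑ k ∈ Finset.range (m + 1),
      (1 / ((m : ℝ) + 1)) * g (((k : ℝ) + 1) / (m + 1)) =
      ∫ r in (0 : ℝ)..1, g (gridTime m r) := by
    intro m
    have hm : (0 : ℝ) < m + 1 := by positivity
    have h1 := intervalIntegral.sum_integral_adjacent_intervals (μ := volume)
      (f := fun r => g (gridTime m r)) (a := fun k : ℕ => (k : ℝ) / (m + 1)) (n := m + 1)
      (fun k _ => hii m _ _)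
    simp only [Nat.cast_zero, zero_div, Nat.cast_add, Nat.cast_one, div_self hm.ne'] at h1
    rw [← h1]
    refine Finset.sum_congr rfl fun k _ => ?_
    have hlt : (k : ℝ) / (m + 1) ≤ ((k : ℝ) + 1) / (m + 1) := by gcongr; linarith
    have h2 : ∫ r in ((k : ℝ) / (m + 1))..(((k : ℝ) + 1) / (m + 1)), g (gridTime m r) =
        ∫ _ in ((k : ℝ) / (m + 1))..(((k : ℝ) + 1) / (m + 1)), g (((k : ℝ) + 1) / (m + 1)) := by
      rw [intervalIntegral.integral_of_le hlt, intervalIntegral.integral_of_le hlt,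
        integral_Ioc_eq_integral_Ioo, integral_Ioc_eq_integral_Ioo]
      refine setIntegral_congr_fun measurableSet_Ioo fun r hr => ?_
      have hfl : ⌊r * ((m : ℝ) + 1)⌋₊ = k := by
        have h3 := (div_lt_iff₀ hm).1 hr.1
        have h4 := (lt_div_iff₀ hm).1 hr.2
        exact (Nat.floor_eq_iff ((Nat.cast_nonneg k).trans h3.le)).2 ⟨h3.le, h4⟩
      simp [gridTime, hfl]
    rw [h2, intervalIntegral.integral_const, smul_eq_mul]
    congr 1
    field_simp
    ring
  simp only [hsum]
  refine intervalIntegral.tendsto_integral_filter_of_dominated_convergence (fun _ => C)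
    (Eventually.of_forall fun m => (hgm m).aestronglyMeasurable)
    (Eventually.of_forall fun m => ae_of_all _ fun r _ => hC _) intervalIntegrable_const
    (ae_of_all _ fun r hr0 => ?_)
  rw [uIoc_of_le zero_le_one] at hr0
  have h1 := NNReal.continuous_coe.continuousWithinAt (s := Ici r.toNNReal) (x := r.toNNReal)
  have h2 : Tendsto (fun m => (gridTime m r : ℝ)) atTop (𝓝[≥] r) := by
    refine tendsto_nhdsWithin_iff.2 ⟨?_, Eventually.of_forall fun m => (lt_gridTime m r).le⟩
    have := h1.tendsto.comp (tendsto_gridTime hr0.1.le)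
    rwa [Real.coe_toNNReal r hr0.1.le] at this
  exact (hr r).tendsto.comp h2

variable {n : ℕ} {p : ℝ≥0 → Fin n}

theorem IsRightContinuous.tendsto_pathLocalTime (hp : IsRightContinuous p) {s : ℝ} (hs : 0 ≤ s)
    (i : Fin n) : Tendsto (fun m : ℕ => ∑ k ∈ Finset.range (m + 1),
      (s / ((m : ℝ) + 1)) * occupation p i (s * (((k : ℝ) + 1) / (m + 1)))) atTop
      (𝓝 (pathLocalTime (p, s) i)) := by
  have h1 := tendsto_rightRiemannSum (g := fun r => occupation p i (s * r))
    (fun r => norm_occupation_le p i (s * r))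
    (fun r => (hp.continuousWithinAt_occupation i (s * r)).comp
      (by fun_prop) (fun r' hr' => mul_le_mul_of_nonneg_left hr' hs))
  have h2 := h1.const_mul s
  rw [hp.pathLocalTime_apply hs]
  have h3 := intervalIntegral.smul_integral_comp_mul_left (a := 0) (b := 1) (occupation p i) s
  rw [mul_zero, mul_one, smul_eq_mul] at h3
  rw [h3] at h2
  refine h2.congr fun m => ?_
  rw [Finset.mul_sum]
  exact Finset.sum_congr rfl fun k _ => by ring

end RiemannSum

/-! ### The Markov property, from finitely many times to local time. -/

section Markov

variable {n : ℕ} {Ω : Type*} [MeasurableSpace Ω] {R : Matrix (Fin n) (Fin n) ℝ} {a : Fin n}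
  {X : ℝ≥0 → Ω → Fin n} {Pr : Measure Ω}

theorem IsMarkovChain.isRightContinuous (hX : IsMarkovChain R a X Pr) (ω : Ω) :
    IsRightContinuous fun t => X t ω := hX.rightContinuous ω

theorem IsMarkovChain.measurable_path (hX : IsMarkovChain R a X Pr) :
    Measurable fun ω t => X t ω := measurable_pi_iff.2 hX.measurable

/-- Appending t to the list of times adds one factor to the product in the finite-dimensional law.
-/
theorem IsMarkovChain.real_inter (hX : IsMarkovChain R a X Pr) {N : ℕ} (τ : Fin (N + 1) → ℝ≥0)
    (hτ : Monotone τ) (h0 : τ 0 = 0) {t : ℝ≥0} (ht : τ (Fin.last N) ≤ t)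
    (c : Fin (N + 1) → Fin n) (x : Fin n) :
    Pr.real {ω | (∀ k, X (τ k) ω = c k) ∧ X t ω = x} =
      Pr.real {ω | ∀ k, X (τ k) ω = c k} *
        NormedSpace.exp (((t : ℝ) - τ (Fin.last N)) • R) (c (Fin.last N)) x := by
  have hmono : Monotone (Fin.snoc (α := fun _ => ℝ≥0) τ t) := by
    intro i j hij
    induction j using Fin.lastCases with
    | last =>
      induction i using Fin.lastCases with
      | last => exact le_rfl
      | cast i =>
        simp only [Fin.snoc_last, Fin.snoc_castSucc]
        exact (hτ (Fin.le_last i)).trans ht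
    | cast j =>
      induction i using Fin.lastCases with
      | last => exact absurd hij (by simp)
      | cast i =>
        simp only [Fin.snoc_castSucc]
        exact hτ (by simpa using hij)
  have hzero : ∀ {α : Type} (f : Fin (N + 1) → α) (y : α),
      (Fin.snoc (α := fun _ => α) f y) 0 = f 0 := fun f y => by
    rw [← Fin.castSucc_zero, Fin.snoc_castSucc]
  have h1 := hX.finiteDimensional (N + 1) (Fin.snoc τ t) (Fin.snoc c x) hmono
    ((hzero τ t).trans h0)
  have h2 := hX.finiteDimensional N τ c hτ h0
  have hset : {ω | (∀ k, X (τ k) ω = c k) ∧ X t ω = x} =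
      {ω | ∀ k, X ((Fin.snoc τ t : Fin (N + 1 + 1) → ℝ≥0) k) ω =
        (Fin.snoc c x : Fin (N + 1 + 1) → Fin n) k} := by
    ext ω
    simp [Fin.forall_fin_succ' (n := N + 1)]
  rw [hset, h1, h2, hzero, Fin.prod_univ_castSucc (n := N), mul_assoc]
  simp [-Fin.castSucc_succ, Fin.succ_castSucc, Fin.succ_last]

variable [IsProbabilityMeasure Pr]

/-- The Markov property for functions of finitely many times. -/
theorem IsMarkovChain.integral_mul_ite (hX : IsMarkovChain R a X Pr) {N : ℕ}
    (τ : Fin (N + 1) → ℝ≥0) (hτ : Monotone τ) (h0 : τ 0 = 0) {t : ℝ≥0}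
    (ht : τ (Fin.last N) ≤ t) (F : (Fin (N + 1) → Fin n) → ℂ) (x : Fin n) :
    ∫ ω, F (fun k => X (τ k) ω) * (if X t ω = x then 1 else 0) ∂Pr =
      ∫ ω, F (fun k => X (τ k) ω) *
        (NormedSpace.exp (((t : ℝ) - τ (Fin.last N)) • R) (X (τ (Fin.last N)) ω) x : ℂ) ∂Pr := by
  have hm1 : ∀ c : Fin (N + 1) → Fin n, MeasurableSet {ω | ∀ k, X (τ k) ω = c k} := fun c => by
    rw [ofPred_forall]
    exact MeasurableSet.iInter fun k => hX.measurable _ (measurableSet_singleton (c k))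
  have hm2 : ∀ c : Fin (N + 1) → Fin n,
      MeasurableSet {ω | (∀ k, X (τ k) ω = c k) ∧ X t ω = x} := fun c =>
    (hm1 c).inter (hX.measurable t (measurableSet_singleton x))
  -- Both integrands are split over the finitely many configurations c at the times τ.
  have hL : ∀ ω, F (fun k => X (τ k) ω) * (if X t ω = x then 1 else 0) =
      ∑ c, indicator {ω | (∀ k, X (τ k) ω = c k) ∧ X t ω = x} (fun _ => F c) ω := by
    intro ω
    classical
    rw [Finset.sum_eq_single fun k => X (τ k) ω]
    · simp [indicator_apply]
    · intro c _ hc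
      exact indicator_of_notMem (fun h => hc (funext fun k => (h.1 k).symm)) _
    · simp
  have hR : ∀ ω, F (fun k => X (τ k) ω) *
      (NormedSpace.exp (((t : ℝ) - τ (Fin.last N)) • R) (X (τ (Fin.last N)) ω) x : ℂ) =
      ∑ c, indicator {ω | ∀ k, X (τ k) ω = c k} (fun _ => F c *
        (NormedSpace.exp (((t : ℝ) - τ (Fin.last N)) • R) (c (Fin.last N)) x : ℂ)) ω := by
    intro ω
    classical
    rw [Finset.sum_eq_single fun k => X (τ k) ω]
    · simp
    · intro c _ hc
      exact indicator_of_notMem (fun h => hc (funext fun k => (h k).symm)) _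
    · simp
  simp only [hL, hR]
  rw [integral_finsetSum _ fun c _ => (integrable_const (F c)).indicator (hm2 c),
    integral_finsetSum _ fun c _ => (integrable_const _).indicator (hm1 c)]
  refine Finset.sum_congr rfl fun c _ => ?_
  rw [integral_indicator_const _ (hm2 c), integral_indicator_const _ (hm1 c),
    hX.real_inter τ hτ h0 ht, Complex.real_smul, Complex.real_smul]
  push_cast
  ring

theorem IsMarkovChain.integral_stateInd (hX : IsMarkovChain R a X Pr) {t : ℝ} (ht : 0 ≤ t)
    (x : Fin n) : ∫ ω, stateInd x (fun s => X s ω, t) ∂Pr =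
      (NormedSpace.exp (t • R) a x : ℂ) := by
  have h1 := hX.integral_mul_ite (N := 0) (fun _ => 0) monotone_const rfl (t := t.toNNReal)
    zero_le (fun _ => 1) x
  simp only [one_mul, NNReal.coe_zero, sub_zero, Real.coe_toNNReal t ht] at h1
  have h2 : ∀ᵐ ω ∂Pr, X 0 ω = a := by
    have h3 := hX.finiteDimensional 0 (fun _ => 0) (fun _ => a) monotone_const rfl
    simp only [if_true, Finset.univ_eq_empty, Finset.prod_empty, mul_one, forall_const] at h3
    have hm : MeasurableSet {ω | X 0 ω = a} := hX.measurable 0 (measurableSet_singleton a)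
    rw [measureReal_def, ENNReal.toReal_eq_one_iff] at h3
    exact (prob_compl_eq_zero_iff hm).2 h3
  calc ∫ ω, stateInd x (fun s => X s ω, t) ∂Pr
      = ∫ ω, (if X t.toNNReal ω = x then 1 else 0) ∂Pr :=
        integral_congr_ae (ae_of_all _ fun ω => (hX.isRightContinuous ω).stateInd_eq ht x)
    _ = ∫ ω, (NormedSpace.exp (t • R) (X 0 ω) x : ℂ) ∂Pr := h1
    _ = ∫ _, (NormedSpace.exp (t • R) a x : ℂ) ∂Pr :=
        integral_congr_ae (by filter_upwards [h2] with ω hω; rw [hω])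
    _ = _ := by simp

/-- The Markov property for functions of the local time. -/
theorem IsMarkovChain.integral_pathLocalTime_mul (hX : IsMarkovChain R a X Pr)
    {g : (Fin n → ℝ) → ℂ} (hg : ContinuousOn g (orthant n)) {C : ℝ}
    (hC : ∀ l ∈ orthant n, ‖g l‖ ≤ C) {s t : ℝ} (hs : 0 ≤ s) (hst : s ≤ t) (y x : Fin n) :
    ∫ ω, g (pathLocalTime (fun r => X r ω, s)) * stateInd y (fun r => X r ω, s) *
        stateInd x (fun r => X r ω, t) ∂Pr =
      (∫ ω, g (pathLocalTime (fun r => X r ω, s)) * stateInd y (fun r => X r ω, s) ∂Pr) *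
        (NormedSpace.exp ((t - s) • R) y x : ℂ) := by
  have ht : 0 ≤ t := hs.trans hst
  -- the Riemann sums of the local time along the grid with `m + 1` cells
  let ρ : (m : ℕ) → (Fin (m + 1 + 1) → Fin n) → Fin n → ℝ := fun m c i =>
    ∑ k : Fin (m + 1), (s / ((m : ℝ) + 1)) * (if c k.succ = i then 1 else 0)
  have hρmem : ∀ m c, ρ m c ∈ orthant n := fun m c i =>
    Finset.sum_nonneg fun k _ => by
      have : 0 ≤ s / ((m : ℝ) + 1) := by positivity
      split_ifs <;> simp [this]
  -- The grid starts at 0, as the finite-dimensional laws require, and ends exactly at s; the sums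
  -- use indices `k.succ`, the right endpoints.
  let τ : (m : ℕ) → Fin (m + 1 + 1) → ℝ≥0 := fun m k => (s * ((k : ℝ) / (m + 1))).toNNReal
  have hτ : ∀ m, Monotone (τ m) := fun m i j hij => by
    refine Real.toNNReal_le_toNNReal ?_
    have : (i : ℝ) ≤ j := by exact_mod_cast hij
    gcongr
  have hτ0 : ∀ m, τ m 0 = 0 := fun m => by simp [τ]
  have hτl : ∀ m, τ m (Fin.last (m + 1)) = s.toNNReal := fun m => by
    have : ((m : ℝ) + 1) / (m + 1) = 1 := div_self (by positivity)
    simp [τ, this]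
  have hρτ : ∀ m ω, ρ m (fun k => X (τ m k) ω) = fun i => ∑ k ∈ Finset.range (m + 1),
      (s / ((m : ℝ) + 1)) * occupation (fun r => X r ω) i (s * (((k : ℝ) + 1) / (m + 1))) := by
    intro m ω
    ext i
    rw [Finset.sum_range]
    simp [ρ, τ, occupation]
  have hlim : ∀ ω, Tendsto (fun m => ρ m (fun k => X (τ m k) ω)) atTop
      (𝓝[orthant n] (pathLocalTime (fun r => X r ω, s))) := fun ω => by
    refine tendsto_nhdsWithin_iff.2 ⟨tendsto_pi_nhds.2 fun i => ?_,
      Eventually.of_forall fun m => hρmem m (fun k => X (τ m k) ω)⟩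
    simp only [hρτ]
    exact (hX.isRightContinuous ω).tendsto_pathLocalTime hs i
  have hglim : ∀ ω, Tendsto (fun m => g (ρ m (fun k => X (τ m k) ω))) atTop
      (𝓝 (g (pathLocalTime (fun r => X r ω, s)))) := fun ω =>
    (hg _ (pathLocalTime_mem_orthant _)).tendsto.comp (hlim ω)
  have hgm : ∀ m, Measurable fun ω => g (ρ m (fun k => X (τ m k) ω)) := fun m => by
    have h1 : Measurable fun c : Fin (m + 1 + 1) → Fin n => g (ρ m c) := measurable_of_countable _
    exact h1.comp (measurable_pi_iff.2 fun k => hX.measurable _)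
  have hsm : ∀ z r, Measurable fun ω => stateInd z (fun s => X s ω, r) := fun z r =>
    (measurable_stateInd z).comp (hX.measurable_path.prodMk measurable_const)
  have hC0 : 0 ≤ C := (norm_nonneg _).trans (hC 0 fun _ => le_rfl)
  have hL : Tendsto (fun m => ∫ ω, g (ρ m (fun k => X (τ m k) ω)) *
      stateInd y (fun r => X r ω, s) * stateInd x (fun r => X r ω, t) ∂Pr) atTop
      (𝓝 (∫ ω, g (pathLocalTime (fun r => X r ω, s)) * stateInd y (fun r => X r ω, s) *
        stateInd x (fun r => X r ω, t) ∂Pr)) := by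
    refine tendsto_integral_of_dominated_convergence (fun _ => C)
      (fun m => (((hgm m).mul (hsm y s)).mul (hsm x t)).aestronglyMeasurable) (integrable_const C)
      (fun m => ae_of_all _ fun ω => ?_)
      (ae_of_all _ fun ω => ((hglim ω).mul_const _).mul_const _)
    rw [norm_mul, norm_mul]
    exact (mul_le_of_le_one_right (by positivity) (norm_stateInd_le _ _)).trans
      ((mul_le_of_le_one_right (by positivity) (norm_stateInd_le _ _)).trans (hC _ (hρmem m (fun k => X (τ m k) ω))))
  have hR : Tendsto (fun m => ∫ ω, g (ρ m (fun k => X (τ m k) ω)) *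
      stateInd y (fun r => X r ω, s) ∂Pr) atTop
      (𝓝 (∫ ω, g (pathLocalTime (fun r => X r ω, s)) * stateInd y (fun r => X r ω, s) ∂Pr)) := by
    refine tendsto_integral_of_dominated_convergence (fun _ => C)
      (fun m => ((hgm m).mul (hsm y s)).aestronglyMeasurable) (integrable_const C)
      (fun m => ae_of_all _ fun ω => ?_) (ae_of_all _ fun ω => (hglim ω).mul_const _)
    rw [norm_mul]
    exact (mul_le_of_le_one_right (by positivity) (norm_stateInd_le _ _)).trans (hC _ (hρmem m (fun k => X (τ m k) ω)))
  -- For each m the sum depends on finitely many times up to s, so the two sequences coincide and so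
  -- do their limits.
  refine tendsto_nhds_unique hL ((hR.mul_const _).congr fun m => ?_)
  have hmk := hX.integral_mul_ite (τ m) (hτ m) (hτ0 m) (t := t.toNNReal)
    (by rw [hτl]; exact Real.toNNReal_le_toNNReal hst)
    (fun c => g (ρ m c) * (if c (Fin.last (m + 1)) = y then 1 else 0)) x
  simp only [hτl, Real.coe_toNNReal s hs, Real.coe_toNNReal t ht] at hmk
  simp only [(hX.isRightContinuous _).stateInd_eq hs, (hX.isRightContinuous _).stateInd_eq ht]
  rw [hmk, ← integral_mul_const]
  refine integral_congr_ae (ae_of_all _ fun ω => ?_)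
  by_cases hy : X s.toNNReal ω = y <;> simp [hy]

end Markov

/-! ### Duhamel's formula and the resolvent equation. -/

section Resolvent

variable {n : ℕ} {Ω : Type*} [MeasurableSpace Ω] {R : Matrix (Fin n) (Fin n) ℝ} {a : Fin n}
  {X : ℝ≥0 → Ω → Fin n} {Pr : Measure Ω}

/-- The path functional `v(𝓛_t) 1{X_t = x}`. -/
noncomputable def weightedState (v : (Fin n → ℝ) → ℂ) (x : Fin n) (q : (ℝ≥0 → Fin n) × ℝ) : ℂ :=
  v (pathLocalTime q) * stateInd x q

theorem measurable_weightedState {v : (Fin n → ℝ) → ℂ} (hv : ContinuousOn v (orthant n))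
    (x : Fin n) : Measurable (weightedState v x) :=
  (measurable_comp_of_continuousOn_orthant hv measurable_pathLocalTime
    pathLocalTime_mem_orthant).mul (measurable_stateInd x)

theorem norm_weightedState_le {v : (Fin n → ℝ) → ℂ} {C : ℝ} (hC : ∀ l ∈ orthant n, ‖v l‖ ≤ C)
    (x : Fin n) (q : (ℝ≥0 → Fin n) × ℝ) : ‖weightedState v x q‖ ≤ C := by
  rw [weightedState, norm_mul]
  exact (mul_le_of_le_one_right (norm_nonneg _) (norm_stateInd_le _ _)).trans
    (hC _ (pathLocalTime_mem_orthant q))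

theorem PropertyF.continuousOn_add {u : (Fin n → ℝ) → ℂ} (hu : PropertyF u) {l : Fin n → ℝ}
    (hl : l ∈ orthant n) : ContinuousOn (fun l' => u (l + l')) (orthant n) :=
  hu.continuousOn.comp (by fun_prop) fun _ hl' => add_mem_orthant hl hl'

theorem PropertyF.continuousOn_partialDeriv_add {u : (Fin n → ℝ) → ℂ} (hu : PropertyF u)
    {l : Fin n → ℝ} (hl : l ∈ orthant n) (y : Fin n) :
    ContinuousOn (fun l' => partialDeriv u y (l + l')) (orthant n) :=
  (hu.continuousOn_partialDeriv y).comp (by fun_prop) fun _ hl' => add_mem_orthant hl hl'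

/-- The expectation of `v(𝓛_t) 1{X_t = x}`. -/
noncomputable def expectState (X : ℝ≥0 → Ω → Fin n) (Pr : Measure Ω) (v : (Fin n → ℝ) → ℂ)
    (x : Fin n) (t : ℝ) : ℂ :=
  ∫ ω, weightedState v x (fun r => X r ω, t) ∂Pr

theorem IsMarkovChain.measurable_path_prod (hX : IsMarkovChain R a X Pr) :
    Measurable fun z : Ω × ℝ => ((fun r => X r z.1, z.2) : (ℝ≥0 → Fin n) × ℝ) :=
  (hX.measurable_path.comp measurable_fst).prodMk measurable_snd

variable [IsProbabilityMeasure Pr]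

theorem norm_expectState_le {v : (Fin n → ℝ) → ℂ} {C : ℝ} (hC : ∀ l ∈ orthant n, ‖v l‖ ≤ C)
    (x : Fin n) (t : ℝ) : ‖expectState X Pr v x t‖ ≤ C := by
  have := norm_integral_le_of_norm_le_const (μ := Pr)
    (ae_of_all _ fun ω => norm_weightedState_le hC x (fun r => X r ω, t))
  rw [expectState]
  simpa using this

theorem IsMarkovChain.measurable_expectState (hX : IsMarkovChain R a X Pr)
    {v : (Fin n → ℝ) → ℂ} (hv : ContinuousOn v (orthant n)) (x : Fin n) :
    Measurable (expectState X Pr v x) :=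
  (((measurable_weightedState hv x).comp
    hX.measurable_path_prod).stronglyMeasurable.integral_prod_left' (μ := Pr)).measurable

/-- Duhamel's formula for the joint law of the chain and its local time. -/
theorem IsMarkovChain.expectState_eq (hX : IsMarkovChain R a X Pr)
    {u : (Fin n → ℝ) → ℂ} (hu : PropertyF u) {l : Fin n → ℝ} (hl : l ∈ orthant n) {t : ℝ}
    (ht : 0 ≤ t) (x : Fin n) : expectState X Pr (fun l' => u (l + l')) x t =
      u l * (NormedSpace.exp (t • R) a x : ℂ) + ∑ y, ∫ s in (0 : ℝ)..t,
        expectState X Pr (fun l' => partialDeriv u y (l + l')) y s *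
          (NormedSpace.exp ((t - s) • R) y x : ℂ) := by
  obtain ⟨C, hC0, hC⟩ := hu.exists_bound_partialDeriv
  have hC' : ∀ y, ∀ l' ∈ orthant n, ‖partialDeriv u y (l + l')‖ ≤ C := fun y l' hl' =>
    hC y _ (add_mem_orthant hl hl')
  have hcd := hu.continuousOn_partialDeriv_add hl
  have hmS : Measurable fun ω => stateInd x (fun r => X r ω, t) :=
    (measurable_stateInd x).comp (hX.measurable_path.prodMk measurable_const)
  have hmW : ∀ y, Measurable fun z : Ω × ℝ =>
      weightedState (fun l' => partialDeriv u y (l + l')) y (fun r => X r z.1, z.2) *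
        stateInd x (fun r => X r z.1, t) := fun y =>
    ((measurable_weightedState (hcd y) y).comp hX.measurable_path_prod).mul
      (hmS.comp measurable_fst)
  have hbW : ∀ y (z : Ω × ℝ),
      ‖weightedState (fun l' => partialDeriv u y (l + l')) y (fun r => X r z.1, z.2) *
        stateInd x (fun r => X r z.1, t)‖ ≤ C := fun y z => by
    rw [norm_mul]
    exact (mul_le_of_le_one_right (norm_nonneg _) (norm_stateInd_le _ _)).trans
      (norm_weightedState_le (hC' y) y _)
  have hiW : ∀ y, Integrable (fun z : Ω × ℝ =>
      weightedState (fun l' => partialDeriv u y (l + l')) y (fun r => X r z.1, z.2) *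
        stateInd x (fun r => X r z.1, t)) (Pr.prod (volume.restrict (Ioc 0 t))) := fun y =>
    (integrable_const C).mono' (hmW y).aestronglyMeasurable (ae_of_all _ (hbW y))
  -- The fundamental theorem along a single path; Fubini and the Markov property at time s then give
  -- the convolution.
  have hpath : ∀ ω, weightedState (fun l' => u (l + l')) x (fun r => X r ω, t) =
      u l * stateInd x (fun r => X r ω, t) + ∫ s in Ioc 0 t, ∑ y,
        weightedState (fun l' => partialDeriv u y (l + l')) y (fun r => X r ω, s) *
          stateInd x (fun r => X r ω, t) := fun ω => by
    simp only [weightedState, ← Finset.sum_mul]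
    rw [(hX.isRightContinuous ω).comp_pathLocalTime_eq hu hl ht, add_mul, integral_mul_const]
  have hiS : Integrable (fun z : Ω × ℝ => ∑ y,
      weightedState (fun l' => partialDeriv u y (l + l')) y (fun r => X r z.1, z.2) *
        stateInd x (fun r => X r z.1, t)) (Pr.prod (volume.restrict (Ioc 0 t))) :=
    integrable_finsetSum _ fun y _ => hiW y
  have hint1 : Integrable (fun ω => stateInd x (fun r => X r ω, t)) Pr :=
    (integrable_const (1 : ℝ)).mono' hmS.aestronglyMeasurable
      (ae_of_all _ fun ω => norm_stateInd_le _ _)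
  rw [expectState]
  simp only [hpath]
  rw [integral_add (hint1.const_mul _) hiS.integral_prod_left, integral_const_mul,
    hX.integral_stateInd ht]
  congr 1
  rw [integral_integral_swap (μ := Pr) (ν := volume.restrict (Ioc 0 t))
    (f := fun ω s => ∑ y,
      weightedState (fun l' => partialDeriv u y (l + l')) y (fun r => X r ω, s) *
        stateInd x (fun r => X r ω, t)) hiS]
  have hslice : ∀ y, ∀ s ∈ Ioc 0 t,
      ∫ ω, weightedState (fun l' => partialDeriv u y (l + l')) y (fun r => X r ω, s) *
        stateInd x (fun r => X r ω, t) ∂Pr =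
      expectState X Pr (fun l' => partialDeriv u y (l + l')) y s *
          (NormedSpace.exp ((t - s) • R) y x : ℂ) := fun y s hs =>
    hX.integral_pathLocalTime_mul (hcd y) (hC' y) hs.1.le hs.2 y x
  have hswap : ∀ s : ℝ, ∫ ω, ∑ y,
      weightedState (fun l' => partialDeriv u y (l + l')) y (fun r => X r ω, s) *
        stateInd x (fun r => X r ω, t) ∂Pr = ∑ y, ∫ ω,
      weightedState (fun l' => partialDeriv u y (l + l')) y (fun r => X r ω, s) *
        stateInd x (fun r => X r ω, t) ∂Pr := fun s =>
    integral_finsetSum _ fun y _ => (integrable_const C).mono'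
      ((hmW y).comp (measurable_id.prodMk measurable_const)).aestronglyMeasurable
      (ae_of_all _ fun ω => hbW y (ω, s))
  simp only [hswap]
  rw [integral_finsetSum _ fun y _ => (hiW y).integral_prod_right]
  refine Finset.sum_congr rfl fun y _ => ?_
  rw [intervalIntegral.integral_of_le ht]
  exact setIntegral_congr_fun measurableSet_Ioc fun s hs => hslice y s hs

theorem IsMarkovChain.integrableOn_exp_mul_expectState (hX : IsMarkovChain R a X Pr)
    {v : (Fin n → ℝ) → ℂ} (hv : ContinuousOn v (orthant n)) {C : ℝ}
    (hC : ∀ l ∈ orthant n, ‖v l‖ ≤ C) {h : ℝ} (hh : 0 < h) (x : Fin n) :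
    IntegrableOn (fun t : ℝ => (Real.exp (-h * t) : ℂ) * expectState X Pr v x t) (Ioi 0) := by
  refine ((integrableOn_exp_mul_Ioi (neg_lt_zero.2 hh) 0).const_mul C).mono' ?_
    (ae_of_all _ fun t => ?_)
  · exact ((by fun_prop : Measurable fun t : ℝ => (Real.exp (-h * t) : ℂ)).mul
      (hX.measurable_expectState hv x)).aestronglyMeasurable
  · rw [norm_mul, Complex.norm_real, Real.norm_of_nonneg (Real.exp_pos _).le, mul_comm]
    exact mul_le_mul_of_nonneg_right (norm_expectState_le hC x t) (Real.exp_pos _).le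

/-- The resolvent equation for the joint law of the chain and its local time. -/
theorem IsMarkovChain.sum_laplace_expectState (hX : IsMarkovChain R a X Pr)
    (hR : ∀ t : ℝ, 0 ≤ t → ∀ i j, |NormedSpace.exp (t • R) i j| ≤ 1)
    {u : (Fin n → ℝ) → ℂ} (hu : PropertyF u) {l : Fin n → ℝ} (hl : l ∈ orthant n)
    {h : ℝ} (hh : 0 < h) (z : Fin n) :
    ∑ x, (∫ t in Ioi (0 : ℝ), (Real.exp (-h * t) : ℂ) *
        expectState X Pr (fun l' => u (l + l')) x t) *
      (((if x = z then h else 0) - R x z : ℝ) : ℂ) =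
    u l * (if a = z then 1 else 0) + ∫ t in Ioi (0 : ℝ), (Real.exp (-h * t) : ℂ) *
        expectState X Pr (fun l' => partialDeriv u z (l + l')) z t := by
  obtain ⟨C, hC0, hC⟩ := hu.exists_bound_partialDeriv
  have hC' : ∀ y, ∀ l' ∈ orthant n, ‖partialDeriv u y (l + l')‖ ≤ C := fun y l' hl' =>
    hC y _ (add_mem_orthant hl hl')
  let K : Fin n → Fin n → ℂ := fun y x =>
    ∫ t in Ioi (0 : ℝ), ((Real.exp (-h * t) * NormedSpace.exp (t • R) y x : ℝ) : ℂ)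
  have hK : ∀ y z, ∑ x, K y x * (((if x = z then h else 0) - R x z : ℝ) : ℂ) =
      if y = z then 1 else 0 := fun y z => by
    have h1 := sum_integral_exp_smul_mul_resolvent hR hh y z
    have h2 := congrArg (fun r : ℝ => (r : ℂ)) h1
    simp only [Complex.ofReal_sum, Complex.ofReal_mul] at h2
    simp only [K, integral_complex_ofReal]
    rw [h2]
    split_ifs <;> simp
  let B : Fin n → ℂ := fun y => ∫ t in Ioi (0 : ℝ), (Real.exp (-h * t) : ℂ) *
        expectState X Pr (fun l' => partialDeriv u y (l + l')) y t
  have hB : ∀ y, IntegrableOn (fun t : ℝ => (Real.exp (-h * t) : ℂ) *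
        expectState X Pr (fun l' => partialDeriv u y (l + l')) y t) (Ioi 0) := fun y =>
    hX.integrableOn_exp_mul_expectState (hu.continuousOn_partialDeriv_add hl y) (hC' y) hh y
  have hKi : ∀ y x, IntegrableOn (fun t : ℝ =>
      ((Real.exp (-h * t) * NormedSpace.exp (t • R) y x : ℝ) : ℂ)) (Ioi 0) := fun y x =>
    (integrableOn_exp_mul_exp_smul_apply hR hh y x).ofReal
  -- Since e^{-ht} = e^{-hs} e^{-h(t-s)}, the weighted Duhamel term is still a convolution, and its
  -- integral is a product.
  have hA : ∀ x, ∫ t in Ioi (0 : ℝ), (Real.exp (-h * t) : ℂ) *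
        expectState X Pr (fun l' => u (l + l')) x t = u l * K a x + ∑ y, B y * K y x := by
    intro x
    have h1 : ∀ t ∈ Ioi (0 : ℝ), (Real.exp (-h * t) : ℂ) *
        expectState X Pr (fun l' => u (l + l')) x t =
        u l * ((Real.exp (-h * t) * NormedSpace.exp (t • R) a x : ℝ) : ℂ) +
        ∑ y, ∫ s in (0 : ℝ)..t, ContinuousLinearMap.mul ℝ ℂ ((Real.exp (-h * s) : ℂ) *
          expectState X Pr (fun l' => partialDeriv u y (l + l')) y s)
          ((Real.exp (-h * (t - s)) * NormedSpace.exp ((t - s) • R) y x : ℝ) : ℂ) := by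
      intro t ht
      rw [hX.expectState_eq hu hl (le_of_lt ht), mul_add, Finset.mul_sum]
      congr 1
      · push_cast; ring
      · refine Finset.sum_congr rfl fun y _ => ?_
        rw [← intervalIntegral.integral_const_mul]
        refine intervalIntegral.integral_congr fun s _ => ?_
        have h2 : Real.exp (-h * t) = Real.exp (-h * s) * Real.exp (-h * (t - s)) := by
          rw [← Real.exp_add]; ring_nf
        simp only [h2, ContinuousLinearMap.mul_apply']
        push_cast; ring
    rw [setIntegral_congr_fun measurableSet_Ioi h1]
    have hconv : ∀ y, IntegrableOn (fun t : ℝ => ∫ s in (0 : ℝ)..t,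
        ContinuousLinearMap.mul ℝ ℂ ((Real.exp (-h * s) : ℂ) *
          expectState X Pr (fun l' => partialDeriv u y (l + l')) y s)
          ((Real.exp (-h * (t - s)) * NormedSpace.exp ((t - s) • R) y x : ℝ) : ℂ)) (Ioi 0) :=
      fun y => (integrable_indicator_iff measurableSet_Ioi).1
        (integrable_posConvolution (hB y) (hKi y x) (ContinuousLinearMap.mul ℝ ℂ))
    rw [integral_add ((hKi a x).const_mul _) (integrable_finsetSum _ fun y _ => hconv y),
      integral_const_mul, integral_finsetSum _ fun y _ => hconv y]
    congr 1
    refine Finset.sum_congr rfl fun y _ => ?_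
    exact integral_posConvolution (hB y) (hKi y x) (ContinuousLinearMap.mul ℝ ℂ)
  -- Multiplication by h - R cancels K, so only y = z survives in the sum over y.
  simp only [hA, add_mul, Finset.sum_add_distrib, Finset.sum_mul]
  rw [Finset.sum_comm]
  simp only [mul_assoc, ← Finset.mul_sum, hK]
  simp [B]

end Resolvent

/-! ### Averaging over the independent exponential time. -/

section ExponentialTime

variable {n : ℕ} {Ω : Type*} [MeasurableSpace Ω] {R : Matrix (Fin n) (Fin n) ℝ} {a : Fin n}
  {X : ℝ≥0 → Ω → Fin n} {Pr : Measure Ω} {ζ : Ω → ℝ} {h : ℝ}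

/-- `ζ` is real-valued, while `localTime` and `pathLocalTime` are identified only at nonnegative
times. -/
theorem ae_pos_of_hasLaw_expMeasure (hh : 0 < h) (hζ : HasLaw ζ (expMeasure h) Pr) : ∀ᵐ ω ∂Pr, 0 < ζ ω := by
  refine ae_of_ae_map hζ.aemeasurable ?_
  rw [hζ.map_eq]
  have h1 : (expMeasure h) (Iic 0) = 0 := by
    rw [expMeasure, gammaMeasure, withDensity_apply _ measurableSet_Iic]
    exact (lintegral_exponentialPDF_eq_antiDeriv hh 0).trans (by simp)
  rw [ae_iff]
  simpa [not_lt, Iic] using h1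

variable [IsProbabilityMeasure Pr]

/-- Integration over an independent exponential time. -/
theorem IsMarkovChain.integral_exponential_time (hX : IsMarkovChain R a X Pr) (hh : 0 < h)
    (hζ : HasLaw ζ (expMeasure h) Pr) (hind : IndepFun (fun ω t => X t ω) ζ Pr)
    {Ψ : (ℝ≥0 → Fin n) × ℝ → ℂ} (hΨ : Measurable Ψ) {C : ℝ} (hC : ∀ q, ‖Ψ q‖ ≤ C) :
    ∫ ω, Ψ (fun r => X r ω, ζ ω) ∂Pr =
      h * ∫ t in Ioi (0 : ℝ), (Real.exp (-h * t) : ℂ) * ∫ ω, Ψ (fun r => X r ω, t) ∂Pr := by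
  have hlaw := (indepFun_iff_map_prod_eq_prod_map_map hX.measurable_path.aemeasurable
    hζ.aemeasurable).1 hind
  rw [hζ.map_eq] at hlaw
  have : IsProbabilityMeasure (Pr.map fun ω t => X t ω) :=
    Measure.isProbabilityMeasure_map hX.measurable_path.aemeasurable
  have : IsProbabilityMeasure (expMeasure h) := isProbabilityMeasure_expMeasure hh
  calc ∫ ω, Ψ (fun r => X r ω, ζ ω) ∂Pr
      = ∫ q, Ψ q ∂(Pr.map fun ω => ((fun r => X r ω), ζ ω)) :=
        (integral_map (hX.measurable_path.aemeasurable.prodMk hζ.aemeasurable)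
          hΨ.aestronglyMeasurable).symm
    _ = ∫ t, ∫ p, Ψ (p, t) ∂(Pr.map fun ω t => X t ω) ∂(expMeasure h) := by
        rw [hlaw, integral_prod_symm]
        exact (integrable_const C).mono' hΨ.aestronglyMeasurable (ae_of_all _ hC)
    _ = ∫ t, ∫ ω, Ψ (fun r => X r ω, t) ∂Pr ∂(expMeasure h) := by
        congr 1 with t
        exact integral_map hX.measurable_path.aemeasurable
          (hΨ.comp (measurable_id.prodMk measurable_const)).aestronglyMeasurable
    _ = ∫ t, (exponentialPDF h t).toReal • ∫ ω, Ψ (fun r => X r ω, t) ∂Pr :=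
        integral_withDensity_eq_integral_toReal_smul
          (measurable_exponentialPDFReal h).ennreal_ofReal
          (ae_of_all _ fun t => ENNReal.ofReal_lt_top) _
    _ = ∫ t in Ioi (0 : ℝ), (h : ℂ) *
          ((Real.exp (-h * t) : ℂ) * ∫ ω, Ψ (fun r => X r ω, t) ∂Pr) := by
        rw [← integral_indicator measurableSet_Ioi]
        have h0 : ∀ᵐ t : ℝ, t ≠ 0 := by simp [ae_iff]
        refine integral_congr_ae (h0.mono fun t ht => ?_)
        rcases lt_or_gt_of_ne ht with ht | ht
        · simp [exponentialPDF_of_neg ht, not_lt.2 ht.le]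
        · have h1 : 0 ≤ h * Real.exp (-(h * t)) := by positivity
          simp only [exponentialPDF_of_nonneg (le_of_lt ht), ENNReal.toReal_ofReal h1,
            indicator_of_mem (show t ∈ Ioi (0 : ℝ) from ht), Complex.real_smul, neg_mul]
          push_cast; ring
    _ = _ := integral_const_mul _ _

end ExponentialTime

/-! ### Combining integration by parts with the resolvent equation. -/

section Isomorphism

variable {n : ℕ} {Ω : Type*} [MeasurableSpace Ω] {Q R : Matrix (Fin n) (Fin n) ℝ} {a : Fin n}
  {X : ℝ≥0 → Ω → Fin n} {Pr : Measure Ω} {ζ : Ω → ℝ} {h : ℝ}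

/-- Stationarity gives the transpose zero row sums, so uniformization applies to the reversed chain.
-/
theorem IsIrreducibleLaplacian.abs_exp_transpose_le (hQ : IsIrreducibleLaplacian Q) (t : ℝ)
    (ht : 0 ≤ t) (i j : Fin n) : |NormedSpace.exp (t • Q.transpose) i j| ≤ 1 :=
  abs_exp_smul_apply_le_one
    (fun i j => by
      have := hQ.add_one_nonneg j i
      simpa [Matrix.one_apply, eq_comm] using this)
    (fun i => by simpa using hQ.sum_col i) ht i j

theorem IsRightContinuous.sum_stateInd {p : ℝ≥0 → Fin n} (hp : IsRightContinuous p) {t : ℝ}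
    (ht : 0 ≤ t) : ∑ x, stateInd x (p, t) = 1 := by
  simp [hp.stateInd_eq ht]

theorem IsMarkovChain.localTime_eq (hX : IsMarkovChain R a X Pr) {t : ℝ} (ht : 0 ≤ t) (ω : Ω) :
    localTime X t ω = pathLocalTime (fun r => X r ω, t) := by
  ext i
  rw [(hX.isRightContinuous ω).pathLocalTime_apply ht]
  rfl

theorem IsMarkovChain.aemeasurable_path_time (hX : IsMarkovChain R a X Pr)
    (hζ : AEMeasurable ζ Pr) :
    AEMeasurable (fun ω => ((fun r => X r ω, ζ ω) : (ℝ≥0 → Fin n) × ℝ)) Pr :=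
  hX.measurable_path.aemeasurable.prodMk hζ

theorem IsMarkovChain.aestronglyMeasurable_comp_add (hX : IsMarkovChain R a X Pr)
    (hζ : AEMeasurable ζ Pr) {v : (Fin n → ℝ) → ℂ} (hv : ContinuousOn v (orthant n)) (r : ℝ) :
    AEStronglyMeasurable (fun z : (Fin n → ℂ) × Ω =>
      v (shiftedSq r z.1 + pathLocalTime (fun s => X s z.2, ζ z.2)))
      ((volume : Measure (Fin n → ℂ)).prod Pr) := by
  have h1 : Measurable fun y : (Fin n → ℂ) × ((ℝ≥0 → Fin n) × ℝ) =>
      v (shiftedSq r y.1 + pathLocalTime y.2) :=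
    measurable_comp_of_continuousOn_orthant hv
      (((continuous_shiftedSq r).measurable.comp measurable_fst).add
        (measurable_pathLocalTime.comp measurable_snd))
      fun y => add_mem_orthant (shiftedSq_mem_orthant r _) (pathLocalTime_mem_orthant _)
  exact (h1.comp_aemeasurable (measurable_fst.aemeasurable.prodMk
    (hX.aemeasurable_path_time hζ).comp_snd)).aestronglyMeasurable

variable [IsProbabilityMeasure Pr]

/-- The resolvent equation for the chain and its local time at an independent exponential time. -/
theorem IsMarkovChain.sum_integral_weightedState (hX : IsMarkovChain R a X Pr)
    (hR : ∀ t : ℝ, 0 ≤ t → ∀ i j, |NormedSpace.exp (t • R) i j| ≤ 1) (hh : 0 < h)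
    (hζ : HasLaw ζ (expMeasure h) Pr) (hind : IndepFun (fun ω t => X t ω) ζ Pr)
    {u : (Fin n → ℝ) → ℂ} (hu : PropertyF u) {l : Fin n → ℝ} (hl : l ∈ orthant n) (z : Fin n) :
    ∑ x, (∫ ω, weightedState (fun l' => u (l + l')) x (fun r => X r ω, ζ ω) ∂Pr) *
      (((if x = z then h else 0) - R x z : ℝ) : ℂ) =
    h * u l * (if a = z then 1 else 0) +
      ∫ ω, weightedState (fun l' => partialDeriv u z (l + l')) z (fun r => X r ω, ζ ω) ∂Pr := by
  obtain ⟨C, -, hC⟩ := hu.exists_bound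
  obtain ⟨C', -, hC'⟩ := hu.exists_bound_partialDeriv
  have h1 : ∀ x, ∫ ω, weightedState (fun l' => u (l + l')) x (fun r => X r ω, ζ ω) ∂Pr =
      h * ∫ t in Ioi (0 : ℝ), (Real.exp (-h * t) : ℂ) *
        expectState X Pr (fun l' => u (l + l')) x t := fun x =>
    hX.integral_exponential_time hh hζ hind (measurable_weightedState (hu.continuousOn_add hl) x)
      (norm_weightedState_le (fun l' hl' => hC _ (add_mem_orthant hl hl')) x)
  have h2 : ∫ ω, weightedState (fun l' => partialDeriv u z (l + l')) z
        (fun r => X r ω, ζ ω) ∂Pr =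
      h * ∫ t in Ioi (0 : ℝ), (Real.exp (-h * t) : ℂ) *
        expectState X Pr (fun l' => partialDeriv u z (l + l')) z t :=
    hX.integral_exponential_time hh hζ hind
      (measurable_weightedState (hu.continuousOn_partialDeriv_add hl z) z)
      (norm_weightedState_le (fun l' hl' => hC' z _ (add_mem_orthant hl hl')) z)
  have h3 := hX.sum_laplace_expectState hR hu hl hh z
  simp only [h1, h2, mul_assoc, ← Finset.mul_sum]
  rw [h3, mul_add]

theorem norm_add_sqrt_le (r : ℝ) (φ : Fin n → ℂ) (x : Fin n) :
    ‖φ x + (Real.sqrt r : ℂ)‖ ≤ (1 + Real.sqrt r) * (1 + ‖φ‖) := by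
  refine (norm_add_le _ _).trans ?_
  rw [Complex.norm_real, Real.norm_of_nonneg (Real.sqrt_nonneg r)]
  have := norm_le_pi_norm φ x
  nlinarith [Real.sqrt_nonneg r, norm_nonneg φ]

/-- Integration by parts at the random level `𝓛_ζ`, on the event that `X_ζ = x`. -/
theorem IsMarkovChain.integral_wirtinger_weightedState (hX : IsMarkovChain R a X Pr)
    (hQ : IsIrreducibleLaplacian Q) (hh : 0 < h) (hζ : AEMeasurable ζ Pr)
    {u : (Fin n → ℝ) → ℂ} (hu : PropertyF u) (r : ℝ) (x : Fin n) :
    Integrable (fun φ : Fin n → ℂ => ((∑ i, φ i * (killedLaplacian Q (fun _ => h) i x : ℂ)) *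
        (∫ ω, weightedState (fun l' => u (shiftedSq r φ + l')) x (fun s => X s ω, ζ ω) ∂Pr) +
      (φ x + (Real.sqrt r : ℂ)) * ∫ ω, weightedState
        (fun l' => partialDeriv u x (shiftedSq r φ + l')) x (fun s => X s ω, ζ ω) ∂Pr) *
      gaussianWeight Q h φ) ∧
    ∫ φ : Fin n → ℂ, ((∑ i, φ i * (killedLaplacian Q (fun _ => h) i x : ℂ)) *
        (∫ ω, weightedState (fun l' => u (shiftedSq r φ + l')) x (fun s => X s ω, ζ ω) ∂Pr) +
      (φ x + (Real.sqrt r : ℂ)) * ∫ ω, weightedState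
        (fun l' => partialDeriv u x (shiftedSq r φ + l')) x (fun s => X s ω, ζ ω) ∂Pr) *
      gaussianWeight Q h φ = 0 := by
  set M := killedLaplacian Q (fun _ => h) with hM
  obtain ⟨C, hC0, hC⟩ := hu.exists_bound
  obtain ⟨C', hC'0, hC'⟩ := hu.exists_bound_partialDeriv
  have hq := hX.aemeasurable_path_time hζ
  have hmem : ∀ φ ω, shiftedSq r φ + pathLocalTime (fun s => X s ω, ζ ω) ∈ orthant n :=
    fun φ ω => add_mem_orthant (shiftedSq_mem_orthant r φ) (pathLocalTime_mem_orthant _)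
  have hint : ∀ {v : (Fin n → ℝ) → ℂ} (φ : Fin n → ℂ), ContinuousOn v (orthant n) →
      ∀ C : ℝ, (∀ l ∈ orthant n, ‖v l‖ ≤ C) → Integrable (fun ω =>
        weightedState (fun l' => v (shiftedSq r φ + l')) x (fun s => X s ω, ζ ω)) Pr := by
    intro v φ hv C hC
    refine (integrable_const C).mono' ?_ (ae_of_all _ fun ω => norm_weightedState_le
      (fun l' hl' => hC _ (add_mem_orthant (shiftedSq_mem_orthant r φ) hl')) x _)
    refine ((measurable_weightedState ?_ x).comp_aemeasurable hq).aestronglyMeasurable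
    exact hv.comp (by fun_prop) fun _ hl' => add_mem_orthant (shiftedSq_mem_orthant r φ) hl'
  let Θ : (Fin n → ℂ) → Ω → ℂ := fun φ ω =>
    (((∑ i, φ i * (M i x : ℂ)) * u (shiftedSq r φ + pathLocalTime (fun s => X s ω, ζ ω)) +
      (φ x + (Real.sqrt r : ℂ)) *
        partialDeriv u x (shiftedSq r φ + pathLocalTime (fun s => X s ω, ζ ω))) *
      gaussianWeight Q h φ) * stateInd x (fun s => X s ω, ζ ω)
  have hΘ : ∀ φ, ∫ ω, Θ φ ω ∂Pr = ((∑ i, φ i * (M i x : ℂ)) *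
        (∫ ω, weightedState (fun l' => u (shiftedSq r φ + l')) x (fun s => X s ω, ζ ω) ∂Pr) +
      (φ x + (Real.sqrt r : ℂ)) * ∫ ω, weightedState
        (fun l' => partialDeriv u x (shiftedSq r φ + l')) x (fun s => X s ω, ζ ω) ∂Pr) *
      gaussianWeight Q h φ := by
    intro φ
    rw [← integral_const_mul, ← integral_const_mul,
      ← integral_add ((hint φ hu.continuousOn C hC).const_mul _)
        ((hint φ (hu.continuousOn_partialDeriv x) C' (hC' x)).const_mul _), ← integral_mul_const]
    congr 1 with ω
    simp only [Θ, weightedState]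
    ring
  let D : ℝ := (∑ i, |M i x|) * C + (1 + Real.sqrt r) * C'
  have hlin : ∀ φ : Fin n → ℂ, ‖∑ i, φ i * (M i x : ℂ)‖ ≤ (∑ i, |M i x|) * (1 + ‖φ‖) := by
    intro φ
    rw [Finset.sum_mul]
    refine norm_sum_le_of_le _ fun i _ => ?_
    rw [norm_mul, Complex.norm_real, Real.norm_eq_abs, mul_comm]
    have := norm_le_pi_norm φ i
    gcongr
    linarith
  have hΘi : Integrable (Function.uncurry Θ) ((volume : Measure (Fin n → ℂ)).prod Pr) := by
    have hdom : Integrable (fun z : (Fin n → ℂ) × Ω =>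
        (D * ((1 + ‖z.1‖) * ‖gaussianWeight Q h z.1‖)) * 1) (volume.prod Pr) :=
      ((integrable_one_add_norm_mul_gaussianWeight hQ hh).const_mul D).mul_prod
        (integrable_const (1 : ℝ))
    refine hdom.mono' ?_ (ae_of_all _ fun z => ?_)
    · have hc1 : Continuous fun z : Fin n → ℂ => ∑ i, z i * (M i x : ℂ) := by fun_prop
      have hc2 : Continuous fun z : Fin n → ℂ => z x + (Real.sqrt r : ℂ) := by fun_prop
      have hs : AEStronglyMeasurable (fun z : (Fin n → ℂ) × Ω =>
          stateInd x (fun s => X s z.2, ζ z.2)) (volume.prod Pr) :=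
        ((measurable_stateInd x).comp_aemeasurable hq.comp_snd).aestronglyMeasurable
      exact ((((hc1.measurable.comp measurable_fst).aestronglyMeasurable.mul
        (hX.aestronglyMeasurable_comp_add hζ hu.continuousOn r)).add
        ((hc2.measurable.comp measurable_fst).aestronglyMeasurable.mul
        (hX.aestronglyMeasurable_comp_add hζ (hu.continuousOn_partialDeriv x) r))).mul
        (continuous_gaussianWeight.measurable.comp measurable_fst).aestronglyMeasurable).mul hs
    · obtain ⟨φ, ω⟩ := z
      simp only [Function.uncurry, Θ, mul_one]
      rw [norm_mul, norm_mul, ← mul_assoc]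
      refine (mul_le_of_le_one_right (by positivity) (norm_stateInd_le _ _)).trans ?_
      gcongr
      refine (norm_add_le _ _).trans ?_
      rw [norm_mul, norm_mul]
      have h1 := mul_le_mul (hlin φ) (hC _ (hmem φ ω)) (norm_nonneg _) (by positivity)
      have h2 := mul_le_mul (norm_add_sqrt_le r φ x) (hC' x _ (hmem φ ω)) (norm_nonneg _)
        (by positivity)
      refine (add_le_add h1 h2).trans (le_of_eq ?_)
      simp only [D]; ring
  refine ⟨hΘi.integral_prod_left.congr (ae_of_all _ hΘ), ?_⟩
  simp only [← hΘ]
  -- With ω frozen, 𝓛_ζ is a fixed point of the orthant and the indicator of X_ζ = x is a constant,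
  -- so the deterministic formula applies.
  rw [integral_integral_swap hΘi]
  refine integral_eq_zero_of_ae (ae_of_all _ fun ω => ?_)
  simp only [Θ]
  rw [integral_mul_const, integral_wirtinger_eq_zero hQ hh hu r (pathLocalTime_mem_orthant _) x]
  simp

/-- The divergence of the vector field in the integration by parts formula, when the weights
solve the resolvent equation. -/
theorem IsIrreducibleLaplacian.sum_divergence_eq (hQ : IsIrreducibleLaplacian Q) (h : ℝ)
    (a : Fin n) (c U : ℂ) (φ W D : Fin n → ℂ)
    (hW : ∀ z, ∑ x, W x * (((if x = z then h else 0) - Q.transpose x z : ℝ) : ℂ) =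
      h * U * (if a = z then 1 else 0) + D z) :
    ∑ x, ((∑ i, φ i * (killedLaplacian Q (fun _ => h) i x : ℂ)) * W x + (φ x + c) * D x) =
      h * c * (∑ x, W x) - h * ((φ a + c) * U) := by
  -- Zero column sums allow φ to be shifted by c in the Q part; the killing part keeps φ, and this
  -- mismatch is the source of the factor c in the conclusion.
  have h1 : ∀ x, ∑ i, φ i * (killedLaplacian Q (fun _ => h) i x : ℂ) =
      ∑ i, (φ i + c) * (Q i x : ℂ) - h * φ x := by
    intro x
    have h2 : ∑ i, (Q i x : ℂ) = 0 := by exact_mod_cast hQ.sum_col x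
    simp only [killedLaplacian, Matrix.sub_apply, Matrix.diagonal_apply, Complex.ofReal_sub,
      mul_sub, add_mul, Finset.sum_sub_distrib, Finset.sum_add_distrib, ← Finset.mul_sum, h2]
    have h3 : ∑ i, φ i * (((if i = x then h else 0 : ℝ)) : ℂ) = h * φ x := by
      rw [Finset.sum_eq_single x]
      · simp [mul_comm]
      · intro i _ hi; simp [hi]
      · simp
    rw [h3]; ring
  have h4 : ∀ z, D z = h * W z - ∑ x, (Q z x : ℂ) * W x - h * U * (if a = z then 1 else 0) := by
    intro z
    rw [eq_sub_iff_add_eq, add_comm, ← hW z]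
    simp only [Complex.ofReal_sub, mul_sub, Finset.sum_sub_distrib, Matrix.transpose_apply]
    congr 1
    · rw [Finset.sum_eq_single z]
      · simp [mul_comm]
      · intro i _ hi; simp [hi]
      · simp
    · exact Finset.sum_congr rfl fun x _ => mul_comm _ _
  simp only [h1, h4]
  have h5 : ∑ x, (φ x + c) * (h * U * (if a = x then 1 else 0)) = h * ((φ a + c) * U) := by
    rw [Finset.sum_eq_single a]
    · simp; ring
    · intro i _ hi; simp [Ne.symm hi]
    · simp
  -- The Q term from the Gaussian and the one from the resolvent equation are the same bilinear form
  -- in φ + c and W, and they cancel.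
  have h6 : ∑ x, (∑ i, (φ i + c) * (Q i x : ℂ)) * W x =
      ∑ x, (φ x + c) * ∑ i, (Q x i : ℂ) * W i := by
    simp only [Finset.sum_mul, Finset.mul_sum]
    rw [Finset.sum_comm]
    simp only [mul_assoc]
  have h7 : ∀ x, (∑ i, (φ i + c) * (Q i x : ℂ) - h * φ x) * W x +
      (φ x + c) * (h * W x - ∑ i, (Q x i : ℂ) * W i - h * U * (if a = x then 1 else 0)) =
      (∑ i, (φ i + c) * (Q i x : ℂ)) * W x - (φ x + c) * (∑ i, (Q x i : ℂ) * W i) +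
      h * c * W x - (φ x + c) * (h * U * (if a = x then 1 else 0)) := fun x => by ring
  simp only [h7, Finset.sum_add_distrib, Finset.sum_sub_distrib]
  rw [h5, h6, ← Finset.mul_sum]
  ring

/-- The state indicators at time ζ sum to 1 wherever ζ > 0, hence almost surely. -/
theorem IsMarkovChain.sum_integral_weightedState_eq (hX : IsMarkovChain R a X Pr) (hh : 0 < h)
    (hζ : HasLaw ζ (expMeasure h) Pr) {v : (Fin n → ℝ) → ℂ} (hv : ContinuousOn v (orthant n))
    {C : ℝ} (hC : ∀ l ∈ orthant n, ‖v l‖ ≤ C) :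
    ∑ x, ∫ ω, weightedState v x (fun s => X s ω, ζ ω) ∂Pr =
      ∫ ω, v (pathLocalTime (fun s => X s ω, ζ ω)) ∂Pr := by
  rw [← integral_finsetSum]
  · refine integral_congr_ae ?_
    filter_upwards [ae_pos_of_hasLaw_expMeasure hh hζ] with ω hω
    simp only [weightedState, ← Finset.mul_sum]
    rw [(hX.isRightContinuous ω).sum_stateInd hω.le, mul_one]
  · intro x _
    exact (integrable_const C).mono' ((measurable_weightedState hv x).comp_aemeasurable
      (hX.aemeasurable_path_time hζ.aemeasurable)).aestronglyMeasurable
      (ae_of_all _ fun ω => norm_weightedState_le hC x _)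

theorem twistedDensity_eq (φ : Fin n → ℂ) : twistedDensity Q (fun _ => h) φ =
    ((Real.pi ^ n * (greenKernel Q (fun _ => h)).det : ℝ) : ℂ)⁻¹ * gaussianWeight Q h φ := rfl

end Isomorphism

end PermanentalIso

/-- Non-reversible Eisenbaum isomorphism. `X` is the reversed chain (its rate matrix is `Qᵀ`) started
at `a`, and `ζ` is exponential with mean `h⁻¹`, independent of `X`. -/
theorem theorem3p5 {n : ℕ} (Q : Matrix (Fin n) (Fin n) ℝ)
    (hQ : PermanentalIso.IsIrreducibleLaplacian Q)
    (u : (Fin n → ℝ) → ℂ) (hu : PermanentalIso.PropertyF u)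
    (a : Fin n) (r : ℝ) (hr : 0 < r) (h : ℝ) (hh : 0 < h)
    {Ω : Type*} [MeasurableSpace Ω] (Pr : Measure Ω) [IsProbabilityMeasure Pr]
    (X : ℝ≥0 → Ω → Fin n) (hX : PermanentalIso.IsMarkovChain Q.transpose a X Pr)
    (ζ : Ω → ℝ) (hζ : HasLaw ζ (expMeasure h) Pr)
    (hind : IndepFun (fun ω t => X t ω) ζ Pr) :
    PermanentalIso.TwistedIntegrable Q (fun _ => h)
      (fun φ => ((φ a + (Real.sqrt r : ℂ)) / (Real.sqrt r : ℂ)) *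
        u (PermanentalIso.shiftedSq r φ)) ∧
    (∀ φ : Fin n → ℂ, Integrable
      (fun ω => u (PermanentalIso.shiftedSq r φ + PermanentalIso.localTime X (ζ ω) ω)) Pr) ∧
    PermanentalIso.TwistedIntegrable Q (fun _ => h)
      (fun φ => ∫ ω, u (PermanentalIso.shiftedSq r φ + PermanentalIso.localTime X (ζ ω) ω) ∂Pr) ∧
    PermanentalIso.twistedIntegral Q (fun _ => h)
      (fun φ => ((φ a + (Real.sqrt r : ℂ)) / (Real.sqrt r : ℂ)) *
        u (PermanentalIso.shiftedSq r φ)) =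
    PermanentalIso.twistedIntegral Q (fun _ => h)
      (fun φ => ∫ ω, u (PermanentalIso.shiftedSq r φ + PermanentalIso.localTime X (ζ ω) ω) ∂Pr) := by
  open PermanentalIso in
  obtain ⟨C, hC0, hC⟩ := hu.exists_bound
  have hsqrt : (Real.sqrt r : ℂ) ≠ 0 := by exact_mod_cast (Real.sqrt_pos.2 hr).ne'
  have hlt : ∀ᵐ ω ∂Pr, localTime X (ζ ω) ω = pathLocalTime (fun s => X s ω, ζ ω) := by
    filter_upwards [ae_pos_of_hasLaw_expMeasure hh hζ] with ω hω
    exact hX.localTime_eq hω.le ω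
  have hlt' : ∀ φ, (fun ω => u (shiftedSq r φ + localTime X (ζ ω) ω)) =ᵐ[Pr]
      fun ω => u (shiftedSq r φ + pathLocalTime (fun s => X s ω, ζ ω)) := fun φ =>
    hlt.mono fun ω hω => by simp only [hω]
  have hcl : ∀ φ : Fin n → ℂ, ContinuousOn (fun l => u (shiftedSq r φ + l)) (orthant n) := fun φ =>
    hu.continuousOn_add (shiftedSq_mem_orthant r φ)
  have hCl : ∀ φ : Fin n → ℂ, ∀ l ∈ orthant n, ‖u (shiftedSq r φ + l)‖ ≤ C := fun φ l hl =>
    hC _ (add_mem_orthant (shiftedSq_mem_orthant r φ) hl)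
  have hEi : ∀ φ, Integrable
      (fun ω => u (shiftedSq r φ + pathLocalTime (fun s => X s ω, ζ ω))) Pr := fun φ =>
    (integrable_const C).mono' ((measurable_comp_of_continuousOn_orthant (hcl φ)
      measurable_pathLocalTime pathLocalTime_mem_orthant).comp_aemeasurable
      (hX.aemeasurable_path_time hζ.aemeasurable)).aestronglyMeasurable
      (ae_of_all _ fun ω => hCl φ _ (pathLocalTime_mem_orthant _))
  have hE : ∀ φ, ∫ ω, u (shiftedSq r φ + localTime X (ζ ω) ω) ∂Pr =
      ∫ ω, u (shiftedSq r φ + pathLocalTime (fun s => X s ω, ζ ω)) ∂Pr := fun φ =>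
    integral_congr_ae (hlt' φ)
  have hA : Integrable fun φ : Fin n → ℂ =>
      ((φ a + (Real.sqrt r : ℂ)) * u (shiftedSq r φ)) * gaussianWeight Q h φ := by
    have hcu : Continuous fun φ : Fin n → ℂ => u (shiftedSq r φ) :=
      hu.continuousOn.comp_continuous (continuous_shiftedSq r) (shiftedSq_mem_orthant r)
    have hc : Continuous fun φ : Fin n → ℂ => φ a + (Real.sqrt r : ℂ) := by fun_prop
    refine integrable_mul_gaussianWeight hQ hh (hc.mul hcu).aestronglyMeasurable
      (C := (1 + Real.sqrt r) * C) fun φ => ?_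
    rw [norm_mul]
    calc _ ≤ ((1 + Real.sqrt r) * (1 + ‖φ‖)) * C :=
          mul_le_mul (norm_add_sqrt_le r φ a) (hC _ (shiftedSq_mem_orthant r φ)) (norm_nonneg _)
            (by positivity)
      _ = _ := by ring
  have hB : Integrable fun φ : Fin n → ℂ =>
      (∫ ω, u (shiftedSq r φ + pathLocalTime (fun s => X s ω, ζ ω)) ∂Pr) *
        gaussianWeight Q h φ := by
    refine integrable_mul_gaussianWeight hQ hh
      (hX.aestronglyMeasurable_comp_add hζ.aemeasurable hu.continuousOn r).integral_prod_right'
      (C := C) fun φ => ?_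
    refine le_trans ?_ (le_mul_of_one_le_right hC0 (by simp : 1 ≤ 1 + ‖φ‖))
    have := norm_integral_le_of_norm_le_const (μ := Pr)
      (ae_of_all _ fun ω => hCl φ _ (pathLocalTime_mem_orthant (fun s => X s ω, ζ ω)))
    simpa using this
  have hsum : ∀ φ : Fin n → ℂ, ∑ x,
      ((∑ i, φ i * (killedLaplacian Q (fun _ => h) i x : ℂ)) *
        (∫ ω, weightedState (fun l' => u (shiftedSq r φ + l')) x (fun s => X s ω, ζ ω) ∂Pr) +
      (φ x + (Real.sqrt r : ℂ)) * ∫ ω, weightedState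
        (fun l' => partialDeriv u x (shiftedSq r φ + l')) x (fun s => X s ω, ζ ω) ∂Pr) *
      gaussianWeight Q h φ =
      h * (Real.sqrt r : ℂ) *
        ((∫ ω, u (shiftedSq r φ + pathLocalTime (fun s => X s ω, ζ ω)) ∂Pr) *
          gaussianWeight Q h φ) -
      h * (((φ a + (Real.sqrt r : ℂ)) * u (shiftedSq r φ)) * gaussianWeight Q h φ) := by
    intro φ
    rw [← Finset.sum_mul, hQ.sum_divergence_eq h a _ (u (shiftedSq r φ)) φ _ _
      (hX.sum_integral_weightedState hQ.abs_exp_transpose_le hh hζ hind hu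
        (shiftedSq_mem_orthant r φ)),
      hX.sum_integral_weightedState_eq hh hζ (hcl φ) (hCl φ)]
    ring
  have hibp := fun x =>
    hX.integral_wirtinger_weightedState hQ hh hζ.aemeasurable hu r x
  have hzero := integral_finsetSum Finset.univ fun x _ => (hibp x).1
  simp only [hsum, (hibp _).2, Finset.sum_const_zero] at hzero
  rw [integral_sub (hB.const_mul _) (hA.const_mul _), integral_const_mul, integral_const_mul]
    at hzero
  have hh' : (h : ℂ) ≠ 0 := by exact_mod_cast hh.ne'
  have key : ∫ φ : Fin n → ℂ,
      ((φ a + (Real.sqrt r : ℂ)) * u (shiftedSq r φ)) * gaussianWeight Q h φ =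
      (Real.sqrt r : ℂ) * ∫ φ : Fin n → ℂ,
        (∫ ω, u (shiftedSq r φ + pathLocalTime (fun s => X s ω, ζ ω)) ∂Pr) *
          gaussianWeight Q h φ := by
    refine mul_left_cancel₀ hh' ?_
    linear_combination -hzero
  -- The normalizing constant multiplies both sides alike, so the determinant never has to be
  -- evaluated.
  set κ : ℂ := ((Real.pi ^ n * (greenKernel Q (fun _ => h)).det : ℝ) : ℂ)⁻¹ with hκ
  have hleft : ∀ φ : Fin n → ℂ, ((φ a + (Real.sqrt r : ℂ)) / (Real.sqrt r : ℂ)) *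
      u (shiftedSq r φ) * twistedDensity Q (fun _ => h) φ = κ / (Real.sqrt r : ℂ) *
      (((φ a + (Real.sqrt r : ℂ)) * u (shiftedSq r φ)) * gaussianWeight Q h φ) := fun φ => by
    rw [twistedDensity_eq]; ring
  have hright : ∀ φ : Fin n → ℂ, (∫ ω, u (shiftedSq r φ + localTime X (ζ ω) ω) ∂Pr) *
      twistedDensity Q (fun _ => h) φ = κ *
      ((∫ ω, u (shiftedSq r φ + pathLocalTime (fun s => X s ω, ζ ω)) ∂Pr) *
        gaussianWeight Q h φ) := fun φ => by
    rw [twistedDensity_eq, hE]; ring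
  refine ⟨?_, fun φ => (hEi φ).congr (hlt' φ).symm, ?_, ?_⟩
  · simp only [TwistedIntegrable, hleft]
    exact hA.const_mul _
  · simp only [TwistedIntegrable, hright]
    exact hB.const_mul _
  · simp only [twistedIntegral, hleft, hright]
    rw [integral_const_mul, integral_const_mul, key]
    field_simp
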